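/- Let $\mathcal{C}$ be a nonempty simplicial set. Suppose that for every finite partially ordered set $\mathcal{P}$ (possibly empty) every map of simplicial sets $f\colon N\mathcal{P}\to\mathcal{C}$ from the nerve of $\mathcal{P}$ extends, along the canonical inclusion $N\mathcal{P}\subseteq (N\mathcal{P})\star 1$, to a map of simplicial sets $(N\mathcal{P})\star 1\to\mathcal{C}$. Here $1=\Delta[0]$ is the terminal simplicial set, and $\star$ is the join of simplicial sets, with $(A\star B)_n = A_n\sqcup B_n\sqcup\bigsqcup_{i+1+j=n}A_i\times B_j$; thus $(N\mathcal{P})\star 1$ is the nerve of $\mathcal{P}$ with a greatest element adjoined. Then $\mathcal{C}$ is weakly contractible, i.e. its geometric realization $|\mathcal{C}|$ is path connected and $\pi_n(|\mathcal{C}|,x)$ is trivial for every $n\ge 1$ and every base point $x\in|\mathcal{C}|$. -/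

import Mathlib

open CategoryTheory Simplicial Opposite Topology

universe u

namespace SSet

/-- An `n`-simplex of the join `A ⋆ B`.  The monotone map `cut : [n] → [1]` decomposes
`{0 < ⋯ < n}` into an initial segment (sent to `0`) and a final segment (sent to `1`), either of
which may be empty.  The field `left` is a simplex of `A` on the initial segment and `right` is a
simplex of `B` on the final segment (no data on an empty segment).  Here a simplex of `A` on a
segment `S ⊆ [n]` is a map to `A` from the simplicial set whose `m`-simplices are the monotone maps
`[m] → [n]` with values in `S`; by the Yoneda lemma it is an element of `A_i` if `S ≅ [i]`.
Hence the set of these triples is `Aₙ ⊔ Bₙ ⊔ ⨆_{i+1+j=n} Aᵢ × Bⱼ`. -/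
structure JoinSimplex (A B : SSet.{u}) (n : SimplexCategory) : Type u where
  /-- The decomposition of the set of vertices. -/
  cut : n ⟶ ⦋1⦌
  /-- The simplex of `A` on the initial segment. -/
  left : ∀ (m : SimplexCategory) (φ : m ⟶ n),
    (∀ i, (φ ≫ cut).toOrderHom i = 0) → A.obj (op m)
  left_map : ∀ (m m' : SimplexCategory) (ψ : m' ⟶ m) (φ : m ⟶ n)
    (h : ∀ i, (φ ≫ cut).toOrderHom i = 0) (h' : ∀ i, ((ψ ≫ φ) ≫ cut).toOrderHom i = 0),
    A.map ψ.op (left m φ h) = left m' (ψ ≫ φ) h'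
  /-- The simplex of `B` on the final segment. -/
  right : ∀ (m : SimplexCategory) (φ : m ⟶ n),
    (∀ i, (φ ≫ cut).toOrderHom i = 1) → B.obj (op m)
  right_map : ∀ (m m' : SimplexCategory) (ψ : m' ⟶ m) (φ : m ⟶ n)
    (h : ∀ i, (φ ≫ cut).toOrderHom i = 1) (h' : ∀ i, ((ψ ≫ φ) ≫ cut).toOrderHom i = 1),
    B.map ψ.op (right m φ h) = right m' (ψ ≫ φ) h'

namespace JoinSimplex

variable {A B : SSet.{u}}

theorem ext' {n : SimplexCategory} {s t : JoinSimplex A B n} (hcut : s.cut = t.cut)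
    (hleft : ∀ m φ h h', s.left m φ h = t.left m φ h')
    (hright : ∀ m φ h h', s.right m φ h = t.right m φ h') : s = t := by
  obtain ⟨c, l, hl, r, hr⟩ := s
  obtain ⟨c', l', hl', r', hr'⟩ := t
  obtain rfl : c = c' := hcut
  obtain rfl : l = l' := by
    funext m φ h
    exact hleft m φ h h
  obtain rfl : r = r' := by
    funext m φ h
    exact hright m φ h h
  rfl

/-- Restriction of a simplex of the join along a morphism `k ⟶ n` of the simplex category. -/
def restrict {k n : SimplexCategory} (f : k ⟶ n) (s : JoinSimplex A B n) :
    JoinSimplex A B k where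
  cut := f ≫ s.cut
  left m φ h := s.left m (φ ≫ f) (by simpa using h)
  left_map m m' ψ φ h h' := by
    simpa using s.left_map m m' ψ (φ ≫ f) (by simpa using h) (by simpa using h')
  right m φ h := s.right m (φ ≫ f) (by simpa using h)
  right_map m m' ψ φ h h' := by
    simpa using s.right_map m m' ψ (φ ≫ f) (by simpa using h) (by simpa using h')

end JoinSimplex

/-- The join `A ⋆ B` of two simplicial sets. -/
def join (A B : SSet.{u}) : SSet.{u} where
  obj n := JoinSimplex A B n.unop
  map f := ↾fun s ↦ s.restrict f.unop
  map_id n := by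
    refine ConcreteCategory.hom_ext _ _ fun s ↦ ?_
    refine JoinSimplex.ext' ?_ ?_ ?_ <;> simp [JoinSimplex.restrict]
  map_comp f g := by
    refine ConcreteCategory.hom_ext _ _ fun s ↦ ?_
    refine JoinSimplex.ext' ?_ ?_ ?_ <;> simp [JoinSimplex.restrict]

/-- The canonical inclusion `A ⟶ A ⋆ B`: the simplices of `A` are the simplices of the join whose
final segment is empty. -/
def joinInl (A B : SSet.{u}) : A ⟶ join A B where
  app n := ↾fun a ↦
    { cut := SimplexCategory.const n.unop ⦋1⦌ 0
      left := fun m φ _ ↦ A.map φ.op a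
      left_map := by simp
      right := fun m φ h ↦ absurd (h 0) (by simp)
      right_map := fun m m' ψ φ h ↦ absurd (h 0) (by simp) }
  naturality n m f := by
    refine ConcreteCategory.hom_ext _ _ fun a ↦ ?_
    refine JoinSimplex.ext' ?_ ?_ ?_
    · rfl
    · intro k φ h h'
      change A.map φ.op (A.map f a) = A.map (φ ≫ f.unop).op a
      simp
    · intro k φ h
      exact absurd (show (0 : Fin 2) = 1 from h 0) (by decide)

/-- A simplicial set `X` is weakly contractible if its geometric realization `|X|` is path
connected (in particular nonempty) and all its homotopy groups `πₙ(|X|, x)`, `n ≥ 1`, are trivial,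
i.e. if `X ⟶ Δ[0]` is a weak homotopy equivalence. -/
def IsWeaklyContractible (X : SSet.{u}) : Prop :=
  PathConnectedSpace (SSet.toTop.obj X) ∧
    ∀ (n : ℕ), 1 ≤ n → ∀ x : SSet.toTop.obj X, Subsingleton (π_ n (SSet.toTop.obj X) x)

end SSet

/-! Write Ex C for `mapsFrom faceCosimplicial C`, whose n-simplices are the maps to C from the
barycentric subdivision of Δ[n]. A map ∂Δ[n] → Ex C amounts to a map to C from the nerve of the
poset of proper faces, and the subdivided simplex is the cone on that nerve. Hence the hypothesis
gives Ex C → 1 the right lifting property against boundary inclusions, and so against all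
monomorphisms (`exists_extension_mapsFrom_faceCosimplicial`).

It remains to pass from Ex C back to C, which is possible after mapping to a Kan complex K. The last
vertex map embeds C in Ex C. The mapping cylinders of the last vertex maps sd Δ[n] → Δ[n] define
`mapsFrom cylCosimplicial K`, of which K is a retract and whose restriction to Ex K is a trivial
fibration (`exists_lift_mapsFromPre`, resting on the anodyne inclusion `Cyl.anodyneLE_latching`).
Therefore every g : C → K factors through C → Ex C. The latter map extends over the cone C ⋆ 1,
hence so does g (`exists_extension_join`).

Take for g the unit C → Sing |C|, whose target is Kan (`kanComplex_toSSet`). Its extension over the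
cone contracts |C| to the image of the cone point (`contractibleSpace_toTop`). Contractibility kills
all homotopy groups, although the contraction may move the base point
(`ContractibleSpace.subsingleton_homotopyGroup`). -/

section HomotopyGroup

/-! ### Homotopy groups of contractible spaces. -/

open unitInterval

/-- The distance of a point of the cube to the centre, normalised to be `1` on the boundary. -/
noncomputable def cubeRadius {N : Type*} [Fintype N] (y : N → I) : ℝ :=
  ‖fun i ↦ 2 * (y i : ℝ) - 1‖

theorem continuous_cubeRadius {N : Type*} [Fintype N] :
    Continuous (cubeRadius : (N → I) → ℝ) := by
  unfold cubeRadius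
  fun_prop

theorem cubeRadius_le_one {N : Type*} [Fintype N] (y : N → I) : cubeRadius y ≤ 1 := by
  refine (pi_norm_le_iff_of_nonneg zero_le_one).2 fun i ↦ ?_
  rw [Real.norm_eq_abs, abs_le]
  constructor <;> linarith [(y i).2.1, (y i).2.2]

theorem cubeRadius_of_mem_boundary {N : Type*} [Fintype N] {y : N → I}
    (hy : y ∈ Cube.boundary N) : cubeRadius y = 1 := by
  refine le_antisymm (cubeRadius_le_one y) ?_
  obtain ⟨i, hi⟩ := hy
  refine le_trans ?_ (norm_le_pi_norm _ i)
  rcases hi with hi | hi <;> norm_num [hi]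

/-- The dilation of the cube from its centre with ratio `c`, clamped to the cube. -/
noncomputable def cubeDilate {N : Type*} (c : ℝ) (y : N → I) : N → I :=
  fun i ↦ Set.projIcc 0 1 zero_le_one (1 / 2 + c * ((y i : ℝ) - 1 / 2))

theorem cubeDilate_one {N : Type*} (y : N → I) : cubeDilate 1 y = y := by
  funext i
  have : (1 / 2 + 1 * ((y i : ℝ) - 1 / 2)) = y i := by ring
  simp only [cubeDilate, this, Set.projIcc_val]

theorem cubeDilate_mem_boundary {N : Type*} [Fintype N] {c : ℝ} (hc : 0 ≤ c) {y : N → I}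
    (h0 : y ∈ Cube.boundary N ∧ 1 ≤ c ∨ (1 ≤ c * cubeRadius y ∧ Nonempty N)) :
    cubeDilate c y ∈ Cube.boundary N := by
  have key : ∃ i, 1 ≤ c * abs (2 * (y i : ℝ) - 1) := by
    rcases h0 with ⟨⟨i, hi⟩, h1⟩ | ⟨h, hN⟩
    · refine ⟨i, ?_⟩
      rcases hi with hi | hi <;> norm_num [hi, h1]
    · obtain ⟨i, hi⟩ := Finite.exists_max fun i ↦ ‖2 * (y i : ℝ) - 1‖
      refine ⟨i, h.trans ?_⟩
      refine mul_le_mul_of_nonneg_left ?_ hc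
      exact (pi_norm_le_iff_of_nonneg (norm_nonneg _)).2 hi
  obtain ⟨i, hi⟩ := key
  refine ⟨i, ?_⟩
  rcases le_total 0 (2 * (y i : ℝ) - 1) with h | h
  · right
    rw [abs_of_nonneg h] at hi
    exact Set.projIcc_of_right_le _ (by linarith)
  · left
    rw [abs_of_nonpos h] at hi
    exact Set.projIcc_of_le_left _ (by linarith)

/-- All homotopy groups of a contractible space are trivial. -/
theorem ContractibleSpace.subsingleton_homotopyGroup {X : Type*} [TopologicalSpace X]
    [ContractibleSpace X] {N : Type*} [Fintype N] [DecidableEq N] [Nonempty N] (x : X) :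
    Subsingleton (HomotopyGroup N X x) := by
  obtain ⟨z, ⟨H⟩⟩ := id_nullhomotopic X
  -- the parameter of the contraction on the collar
  let τ : I → (N → I) → I := fun s y ↦
    Set.projIcc 0 1 zero_le_one (min (s : ℝ) (2 * (1 - cubeRadius y)))
  -- The ratio runs from 1 to 2. At time `s` the dilated loop takes the value `x` on the shell
  -- `cubeRadius y ≥ 1 - s / 2`; the parameter `τ` equals `s` inside this shell and decreases to `0`
  -- across it.
  let c : I → ℝ := fun s ↦ (1 - (s : ℝ) / 2)⁻¹
  have hpos : ∀ s : I, 0 < 1 - (s : ℝ) / 2 := fun s ↦ by linarith [s.2.2]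
  have hc : ∀ s, 1 ≤ c s := fun s ↦ by
    rw [one_le_inv₀ (hpos s)]
    linarith [s.2.1]
  have hτ_bd : ∀ s y, y ∈ Cube.boundary N → τ s y = 0 := fun s y hy ↦ by
    refine Set.projIcc_of_le_left _ ?_
    rw [cubeRadius_of_mem_boundary hy]
    simp
  have hτ_zero : ∀ y, τ 0 y = 0 := fun y ↦ Set.projIcc_of_le_left _ (by simp)
  have hτ_cont : Continuous fun p : I × (N → I) ↦ τ p.1 p.2 := by
    have := continuous_cubeRadius (N := N)
    refine continuous_projIcc.comp ?_
    fun_prop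
  have hc_cont : Continuous c := by
    refine Continuous.inv₀ (by fun_prop) fun s ↦ (hpos s).ne'
  have hdil : Continuous fun p : I × (N → I) ↦ cubeDilate (c p.1) p.2 := by
    refine continuous_pi fun i ↦ continuous_projIcc.comp ?_
    fun_prop
  -- In the inner half of the cube `τ 1 y = 1`, where `H` is constant; in the outer half the dilated
  -- loop already takes the value `x`.
  have main : ∀ f : GenLoop N X x, ∀ y, H (τ 1 y, f (cubeDilate (c 1) y)) = H (τ 1 y, x) := by
    intro f y
    rcases le_total (cubeRadius y) (1 / 2) with h | h
    · have : τ 1 y = 1 := Set.projIcc_of_right_le _ (by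
        simp only [Set.Icc.coe_one, le_inf_iff, le_refl, true_and]
        linarith)
      rw [this]
      simp
    · congr 2
      refine f.2 _ (cubeDilate_mem_boundary (by linarith [hc 1]) (Or.inr ⟨?_, inferInstance⟩))
      simp only [c, Set.Icc.coe_one]
      norm_num
      linarith
  -- The end of the homotopy does not depend on `f`, so all loops are homotopic to each other
  -- relative to the boundary.
  have key : ∀ f : GenLoop N X x, ∃ g : C(N → I, X), (∀ y, g y = H (τ 1 y, x)) ∧
      ContinuousMap.HomotopicRel f.1 g (Cube.boundary N) := by
    intro f
    refine ⟨⟨fun y ↦ H (τ 1 y, x), ?_⟩, fun _ ↦ rfl, ⟨⟨⟨⟨fun p ↦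
      H (τ p.1 p.2, f (cubeDilate (c p.1) p.2)), ?_⟩, ?_, ?_⟩, ?_⟩⟩⟩
    · have : Continuous fun y ↦ τ 1 y := hτ_cont.comp (by fun_prop : Continuous fun y ↦ ((1 : I), y))
      fun_prop
    · have : Continuous fun p : I × (N → I) ↦ f (cubeDilate (c p.1) p.2) :=
        f.1.continuous.comp hdil
      fun_prop
    · intro y
      have h1 : c 0 = 1 := by simp [c]
      simp only [hτ_zero, h1, cubeDilate_one]
      simp
    · intro y
      exact main f y
    · intro s y hy
      simp only [ContinuousMap.coe_mk, hτ_bd s y hy]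
      rw [GenLoop.boundary f _ (cubeDilate_mem_boundary (by linarith [hc s]) (Or.inl ⟨hy, hc s⟩))]
      simpa using (GenLoop.boundary f y hy).symm
  refine ⟨fun a b ↦ ?_⟩
  induction a using Quotient.inductionOn with | _ f
  induction b using Quotient.inductionOn with | _ g
  obtain ⟨f', hf', hf⟩ := key f
  obtain ⟨g', hg', hg⟩ := key g
  obtain rfl : f' = g' := ContinuousMap.ext fun y ↦ (hf' y).trans (hg' y).symm
  exact Quotient.sound (hf.trans hg.symm)

end HomotopyGroup

namespace SSet

open MonoidalCategory CartesianMonoidalCategory HomotopicalAlgebra modelCategoryQuillen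

/-! ### Anodyne extensions: deformation retracts and cancellation. -/

section Anodyne

variable {A B D E S Z : SSet.{u}}

/-- The lifting property of a fibration against a pushout-product which is an anodyne extension. -/
theorem exists_lift_prod (f : A ⟶ B) (T : Z.Subcomplex)
    (hf : anodyneExtensions f ∨ (Mono f ∧ anodyneExtensions T.ι)) (p : E ⟶ S) [Fibration p]
    (a : B ⊗ (T : SSet) ⟶ E) (b : A ⊗ Z ⟶ E) (v : B ⊗ Z ⟶ S)
    (hab : f ▷ (T : SSet) ≫ a = A ◁ T.ι ≫ b)
    (ha : a ≫ p = B ◁ T.ι ≫ v) (hb : b ≫ p = f ▷ Z ≫ v) :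
    ∃ l : B ⊗ Z ⟶ E, B ◁ T.ι ≫ l = a ∧ f ▷ Z ≫ l = b ∧ l ≫ p = v := by
  let sq := Functor.PushoutObjObj.ofHasPushout (curriedTensor SSet) f T.ι
  have hl : sq.inl ≫ sq.ι = B ◁ T.ι := sq.inl_ι
  have hr : sq.inr ≫ sq.ι = f ▷ Z := sq.inr_ι
  have hsq : anodyneExtensions sq.ι := by
    rcases hf with hf | ⟨_, hT⟩
    · exact anodyneExtensions_pushoutObjObjι' sq hf
    · exact anodyneExtensions_pushoutObjObjι sq hT
  have := hsq p ((modelCategoryQuillen.fibration_iff p).1 inferInstance)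
  have comm : CommSq (sq.isPushout.desc a b hab) sq.ι p v := ⟨by
    refine sq.isPushout.hom_ext ?_ ?_
    · rw [IsPushout.inl_desc_assoc, ha, reassoc_of% hl]
    · rw [IsPushout.inr_desc_assoc, hb, reassoc_of% hr]⟩
  refine ⟨comm.lift, ?_, ?_, comm.fac_right⟩
  · rw [← hl, Category.assoc, comm.fac_left, IsPushout.inl_desc]
  · rw [← hr, Category.assoc, comm.fac_left, IsPushout.inr_desc]

/-- The inclusion `X ⟶ X ⊗ Δ[1]` at the vertex `k`. -/
noncomputable def ιEnd (k : Fin 2) (X : SSet.{u}) : X ⟶ X ⊗ Δ[1] :=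
  lift (𝟙 X) (const (stdSimplex.obj₀Equiv.{u}.symm k))

theorem ιEnd_comp (k : Fin 2) (f : A ⟶ B) : ιEnd k A ≫ f ▷ _ = f ≫ ιEnd k B := rfl

theorem ιEnd_fst (k : Fin 2) : ιEnd k A ≫ fst A _ = 𝟙 A := rfl

theorem stdSimplex_one_ext {m : SimplexCategoryᵒᵖ} {s t : (Δ[1] : SSet.{u}).obj m}
    (h : ∀ i, stdSimplex.asOrderHom s i = stdSimplex.asOrderHom t i) : s = t :=
  stdSimplex.objEquiv.injective (SimplexCategory.Hom.ext _ _ (OrderHom.ext _ _ (funext h)))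

theorem eq_const_of_forall (k : Fin 2) {m : SimplexCategoryᵒᵖ} (x : A.obj m)
    (t : (Δ[1] : SSet.{u}).obj m) (ht : ∀ i, stdSimplex.asOrderHom t i = k) :
    t = (const (X := A) (stdSimplex.obj₀Equiv.{u}.symm k)).app m x :=
  stdSimplex_one_ext ht

theorem asOrderHom_eq_of_mem_horn_one (k : Fin 2) {m : SimplexCategoryᵒᵖ}
    (t : (Δ[1] : SSet.{u}).obj m) (ht : t ∈ (Λ[1, k] : (Δ[1] : SSet.{u}).Subcomplex).obj m) (i) :
    stdSimplex.asOrderHom t i = k := by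
  by_contra hi
  refine ht (Set.eq_univ_of_forall fun j ↦ ?_)
  by_cases hj : j = k
  · exact Or.inr hj
  · exact Or.inl ⟨i, by omega⟩

theorem asOrderHom_eq_of_mem_boundary_one {m : SimplexCategoryᵒᵖ}
    (t : (Δ[1] : SSet.{u}).obj m) (ht : t ∈ (∂Δ[1] : (Δ[1] : SSet.{u}).Subcomplex).obj m) (i) :
    stdSimplex.asOrderHom t i = stdSimplex.asOrderHom t 0 := by
  by_contra hi
  refine ht fun j ↦ ?_
  by_cases hj : j = stdSimplex.asOrderHom t 0
  · exact ⟨0, hj.symm⟩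
  · exact ⟨i, by omega⟩

/-- The horn `Λ[1, k]` is the single vertex `k`, so lifting problems on its pushout-product
prescribe one end of a homotopy. -/
theorem horn_one_comp (k : Fin 2) (h : B ⊗ Δ[1] ⟶ E) :
    B ◁ (Λ[1, k] : (Δ[1] : SSet.{u}).Subcomplex).ι ≫ h = fst B _ ≫ ιEnd k B ≫ h := by
  refine NatTrans.ext (funext fun m ↦ ConcreteCategory.hom_ext _ _ fun x ↦ ?_)
  change h.app m (x.1, x.2.1) = h.app m (x.1, _)
  congr 2
  exact eq_const_of_forall k x.1 _ (asOrderHom_eq_of_mem_horn_one k _ x.2.2)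

/-- The inclusion of a strong deformation retract is an anodyne extension. -/
theorem anodyneExtensions.of_deformation (f : A ⟶ B) (r : B ⟶ A) (hfr : f ≫ r = 𝟙 A)
    (k : Fin 2) (h : B ⊗ Δ[1] ⟶ B) (hk : ιEnd k B ≫ h = r ≫ f)
    (hk' : ιEnd k.rev B ≫ h = 𝟙 B) (hrel : f ▷ Δ[1] ≫ h = fst A _ ≫ f) :
    anodyneExtensions f := by
  intro E S p hp
  have : Fibration p := (modelCategoryQuillen.fibration_iff p).2 hp
  have : Mono f := (SplitMono.mk r hfr).mono
  refine ⟨fun {u v} sq ↦ ?_⟩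
  -- Lift the homotopy `h ≫ v`, starting from `r ≫ u` at the end `k` and stationary on `A`. The
  -- other end of the lift is the required diagonal.
  obtain ⟨l, h1, h2, h3⟩ := exists_lift_prod f (Λ[1, k] : (Δ[1] : SSet.{u}).Subcomplex)
    (Or.inr ⟨this, anodyneExtensions.horn_ι k⟩) p (fst B _ ≫ r ≫ u) (fst A _ ≫ u) (h ≫ v)
    (by rw [whiskerRight_fst_assoc, reassoc_of% hfr, whiskerLeft_fst_assoc])
    (by rw [reassoc_of% (horn_one_comp k h), reassoc_of% hk]; simp [sq.w])
    (by rw [reassoc_of% hrel, Category.assoc, sq.w])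
  refine ⟨⟨⟨ιEnd k.rev B ≫ l, ?_, ?_⟩⟩⟩
  · rw [← reassoc_of% (ιEnd_comp k.rev f), h2, reassoc_of% (ιEnd_fst k.rev)]
  · rw [Category.assoc, h3, reassoc_of% hk']

/-- The morphism `B ⊗ ∂Δ[1] ⟶ E` given by two morphisms `B ⟶ E`. -/
noncomputable def boundaryOneDesc (g₀ g₁ : B ⟶ E) :
    B ⊗ ((∂Δ[1] : (Δ[1] : SSet.{u}).Subcomplex) : SSet.{u}) ⟶ E where
  app m := ↾fun x ↦ if stdSimplex.asOrderHom x.2.1 0 = 0 then g₀.app m x.1 else g₁.app m x.1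
  naturality m m' φ := by
    refine ConcreteCategory.hom_ext _ _ fun x ↦ ?_
    have h : stdSimplex.asOrderHom ((Δ[1] : SSet.{u}).map φ x.2.1) 0 =
        stdSimplex.asOrderHom x.2.1 0 :=
      asOrderHom_eq_of_mem_boundary_one x.2.1 x.2.2 (φ.unop.toOrderHom 0)
    change (if stdSimplex.asOrderHom ((Δ[1] : SSet.{u}).map φ x.2.1) 0 = 0 then
      g₀.app m' (B.map φ x.1) else g₁.app m' (B.map φ x.1)) = E.map φ (if _ then _ else _)
    rw [h]
    split_ifs
    · exact NatTrans.naturality_apply g₀ φ x.1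
    · exact NatTrans.naturality_apply g₁ φ x.1

theorem boundaryOneDesc_eq (h : B ⊗ Δ[1] ⟶ E) :
    B ◁ (∂Δ[1] : (Δ[1] : SSet.{u}).Subcomplex).ι ≫ h =
      boundaryOneDesc (ιEnd 0 B ≫ h) (ιEnd 1 B ≫ h) := by
  refine NatTrans.ext (funext fun m ↦ ConcreteCategory.hom_ext _ _ fun x ↦ ?_)
  change h.app m (x.1, x.2.1) = if stdSimplex.asOrderHom x.2.1 0 = 0 then
    h.app m (x.1, _) else h.app m (x.1, _)
  have hx := asOrderHom_eq_of_mem_boundary_one x.2.1 x.2.2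
  split_ifs with h0
  · congr 2
    exact eq_const_of_forall 0 x.1 _ fun i ↦ (hx i).trans h0
  · congr 2
    exact eq_const_of_forall 1 x.1 _ fun i ↦ (hx i).trans (Fin.eq_one_of_ne_zero _ h0)

theorem ιEnd_of_boundaryOneDesc (h : B ⊗ Δ[1] ⟶ E) (g₀ g₁ : B ⟶ E)
    (H : B ◁ (∂Δ[1] : (Δ[1] : SSet.{u}).Subcomplex).ι ≫ h = boundaryOneDesc g₀ g₁) :
    ιEnd 0 B ≫ h = g₀ ∧ ιEnd 1 B ≫ h = g₁ := by
  have key (k : Fin 2) {m : SimplexCategoryᵒᵖ} (x : B.obj m) :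
      (const (X := B) (stdSimplex.obj₀Equiv.{u}.symm k)).app m x ∈
        (∂Δ[1] : (Δ[1] : SSet.{u}).Subcomplex).obj m := by
    intro hs
    -- In `Fin 2`, `k + 1` is the other vertex, which a constant simplex misses.
    obtain ⟨i, hi⟩ := hs (k + 1)
    change k = k + 1 at hi
    omega
  constructor
  · refine NatTrans.ext (funext fun m ↦ ConcreteCategory.hom_ext _ _ fun x ↦ ?_)
    let t : ((∂Δ[1] : (Δ[1] : SSet.{u}).Subcomplex) : SSet.{u}).obj m := Subtype.mk _ (key 0 x)
    let y : (B ⊗ ((∂Δ[1] : (Δ[1] : SSet.{u}).Subcomplex) : SSet.{u})).obj m := (x, t)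
    exact ConcreteCategory.congr_hom (NatTrans.congr_app H m) y
  · refine NatTrans.ext (funext fun m ↦ ConcreteCategory.hom_ext _ _ fun x ↦ ?_)
    let t : ((∂Δ[1] : (Δ[1] : SSet.{u}).Subcomplex) : SSet.{u}).obj m := Subtype.mk _ (key 1 x)
    let y : (B ⊗ ((∂Δ[1] : (Δ[1] : SSet.{u}).Subcomplex) : SSet.{u})).obj m := (x, t)
    exact ConcreteCategory.congr_hom (NatTrans.congr_app H m) y

theorem comp_boundaryOneDesc (f : A ⟶ B) (g₀ g₁ : B ⟶ E) :
    f ▷ _ ≫ boundaryOneDesc g₀ g₁ = boundaryOneDesc (f ≫ g₀) (f ≫ g₁) := rfl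

theorem boundaryOneDesc_comp (g₀ g₁ : B ⟶ E) (p : E ⟶ S) :
    boundaryOneDesc g₀ g₁ ≫ p = boundaryOneDesc (g₀ ≫ p) (g₁ ≫ p) := by
  refine NatTrans.ext (funext fun m ↦ ConcreteCategory.hom_ext _ _ fun x ↦ ?_)
  exact apply_ite (p.app m) _ _ _

/-- Right cancellation for anodyne extensions. -/
theorem anodyneExtensions.of_precomp (f : A ⟶ B) (g : B ⟶ D) [Mono g]
    (hf : anodyneExtensions f) (hfg : anodyneExtensions (f ≫ g)) : anodyneExtensions g := by
  intro E S p hp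
  have : Fibration p := (modelCategoryQuillen.fibration_iff p).2 hp
  refine ⟨fun {u v} sq ↦ ?_⟩
  have := hfg p hp
  have sq' : CommSq (f ≫ u) (f ≫ g) p v := ⟨by simp [sq.w]⟩
  -- The maps `g ≫ sq'.lift` and `u` agree on `A` and over `S`. Since `f` is anodyne, they are
  -- homotopic relative to `A` and over `S`.
  obtain ⟨h, h1, h2, h3⟩ := exists_lift_prod f (∂Δ[1] : (Δ[1] : SSet.{u}).Subcomplex)
    (Or.inl hf) p (boundaryOneDesc (g ≫ sq'.lift) u) (fst A _ ≫ f ≫ u) (fst B _ ≫ g ≫ v)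
    (by
      have h0 : f ≫ g ≫ sq'.lift = f ≫ u := by rw [← Category.assoc, sq'.fac_left]
      rw [boundaryOneDesc_eq, comp_boundaryOneDesc, reassoc_of% (ιEnd_fst (A := A)), h0,
        reassoc_of% (ιEnd_fst (A := A))])
    (by
      rw [boundaryOneDesc_eq, boundaryOneDesc_comp, reassoc_of% (ιEnd_fst (A := B)),
        reassoc_of% (ιEnd_fst (A := B)), Category.assoc, sq'.fac_right, sq.w])
    (by simp [sq.w])
  obtain ⟨h0, h1⟩ := ιEnd_of_boundaryOneDesc _ _ _ h1
  -- Extending this homotopy along `g`, over `S` and starting from `sq'.lift`, produces at time 1 a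
  -- lift that restricts to `u` exactly.
  obtain ⟨l, l1, l2, l3⟩ := exists_lift_prod g (Λ[1, 0] : (Δ[1] : SSet.{u}).Subcomplex)
    (Or.inr ⟨inferInstance, anodyneExtensions.horn_ι _⟩) p (fst D _ ≫ sq'.lift) h (fst D _ ≫ v)
    (by rw [horn_one_comp, h0]; simp)
    (by simp)
    (by rw [h3]; simp)
  refine ⟨⟨⟨ιEnd 1 D ≫ l, ?_, ?_⟩⟩⟩
  · rw [← reassoc_of% (ιEnd_comp 1 g), l2, h1]
  · rw [Category.assoc, l3, reassoc_of% (ιEnd_fst (A := D))]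

/-- Adding to a subcomplex `B` a subcomplex `A` along an anodyne extension. -/
theorem anodyneExtensions_homOfLE_sup {X : SSet.{u}} (A B : X.Subcomplex)
    (h : anodyneExtensions (Subcomplex.homOfLE (inf_le_left : A ⊓ B ≤ A))) :
    anodyneExtensions (Subcomplex.homOfLE (le_sup_right : B ≤ A ⊔ B)) := by
  have sq : Subcomplex.BicartSq (A ⊓ B) A B (A ⊔ B) := ⟨rfl, rfl⟩
  exact MorphismProperty.of_isPushout sq.isPushout.flip h

end Anodyne

section AnodyneLE

variable {X : SSet.{u}}

/-- The inclusion of the subcomplex `A` in the subcomplex `B` is an anodyne extension. -/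
def AnodyneLE (A B : X.Subcomplex) : Prop :=
  ∃ h : A ≤ B, anodyneExtensions (Subcomplex.homOfLE h)

variable {A B D : X.Subcomplex}

theorem AnodyneLE.refl (A : X.Subcomplex) : AnodyneLE A A :=
  ⟨le_rfl, anodyneExtensions.of_isIso (𝟙 _)⟩

theorem AnodyneLE.trans (hAB : AnodyneLE A B) (hBD : AnodyneLE B D) : AnodyneLE A D := by
  obtain ⟨h, hAB⟩ := hAB
  obtain ⟨h', hBD⟩ := hBD
  exact ⟨h.trans h', MorphismProperty.comp_mem _ _ _ hAB hBD⟩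

theorem AnodyneLE.of_left (hAB : AnodyneLE A B) (hAD : AnodyneLE A D) (hBD : B ≤ D) :
    AnodyneLE B D := by
  obtain ⟨h, hAB⟩ := hAB
  obtain ⟨h', hAD⟩ := hAD
  exact ⟨hBD, anodyneExtensions.of_precomp (Subcomplex.homOfLE h) _ hAB hAD⟩

theorem AnodyneLE.sup (h : AnodyneLE (A ⊓ B) A) : AnodyneLE B (A ⊔ B) := by
  obtain ⟨_, h⟩ := h
  exact ⟨le_sup_right, anodyneExtensions_homOfLE_sup A B h⟩

end AnodyneLE

/-! ### Nerves of partially ordered sets and extremal elements. -/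

section Nerve

variable {P : Type u} [PartialOrder P]

/-- The simplex of the nerve of a partially ordered set given by a monotone map. -/
def nerveMk {n : SimplexCategoryᵒᵖ} (f : Fin (n.unop.len + 1) →o P) : (nerve P).obj n :=
  f.monotone.functor

theorem nerve_ext {n : SimplexCategoryᵒᵖ} {s t : (nerve P).obj n} (h : ∀ i, s.obj i = t.obj i) :
    s = t :=
  nerve.ext_of_isThin (funext h)

theorem nerve_monotone {n : SimplexCategoryᵒᵖ} (s : (nerve P).obj n) : Monotone s.obj :=
  fun _ _ h ↦ leOfHom (s.map (homOfLE h))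

/-- The subcomplex of the nerve of a partially ordered set that is spanned by a subset. -/
def nerveOn (T : Set P) : (nerve P).Subcomplex where
  obj _ := {s | ∀ i, s.obj i ∈ T}
  map f _ hs i := hs (f.unop.toOrderHom i)

theorem mem_nerveOn {T : Set P} {n : SimplexCategoryᵒᵖ} {s : (nerve P).obj n} :
    s ∈ (nerveOn T).obj n ↔ ∀ i, s.obj i ∈ T := Iff.rfl

theorem nerveOn_mono {T T' : Set P} (h : T ⊆ T') : nerveOn T ≤ nerveOn T' :=
  fun _ _ hs i ↦ h (hs i)

/-- The contraction of the nerve of a partially ordered set `T` to an extremal element `z`. -/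
noncomputable def nerveOnContraction (T : Set P) (z : P) (hz : z ∈ T) (k : Fin 2)
    (hk : (k = 1 ∧ ∀ t ∈ T, t ≤ z) ∨ (k = 0 ∧ ∀ t ∈ T, z ≤ t)) :
    (nerveOn T : SSet.{u}) ⊗ Δ[1] ⟶ (nerveOn T : SSet.{u}) where
  app m := ↾fun x ↦ ⟨nerveMk
    { toFun := fun i ↦ if stdSimplex.asOrderHom x.2 i = k then z else x.1.1.obj i
      monotone' := fun i j hij ↦ by
        have h1 := (stdSimplex.asOrderHom x.2).monotone hij
        have h2 := nerve_monotone x.1.1 hij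
        dsimp only
        rcases hk with ⟨rfl, hk⟩ | ⟨rfl, hk⟩
        · split_ifs with h3 h4
          · exact le_rfl
          · rw [h3] at h1
            exact absurd (le_antisymm (Fin.le_last _) h1) h4
          · exact hk _ (x.1.2 i)
          · exact h2
        · split_ifs with h3 h4 h5
          · exact le_rfl
          · exact hk _ (x.1.2 j)
          · rw [h5] at h1
            exact absurd (le_antisymm h1 (Fin.zero_le _)) h3
          · exact h2 }, fun i ↦ by
      change (if _ then _ else _) ∈ T
      split_ifs
      · exact hz
      · exact x.1.2 i⟩
  naturality m m' φ := by
    refine ConcreteCategory.hom_ext _ _ fun x ↦ Subtype.ext (nerve_ext fun i ↦ rfl)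

/-- Comparability of `z` with all of `T` is a homotopy, fixing `z`, between the identity and the
constant map. Whether `z` is greatest or least decides which end of Δ[1] carries the constant map.
-/
theorem AnodyneLE.nerveOn_singleton {T : Set P} {z : P} (hz : z ∈ T)
    (h : (∀ t ∈ T, t ≤ z) ∨ (∀ t ∈ T, z ≤ t)) : AnodyneLE (nerveOn {z}) (nerveOn T) := by
  obtain ⟨k, hk⟩ : ∃ k : Fin 2, (k = 1 ∧ ∀ t ∈ T, t ≤ z) ∨ (k = 0 ∧ ∀ t ∈ T, z ≤ t) := by
    rcases h with h | h
    · exact ⟨1, Or.inl ⟨rfl, h⟩⟩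
    · exact ⟨0, Or.inr ⟨rfl, h⟩⟩
  refine ⟨nerveOn_mono (by simpa using hz), ?_⟩
  let r : (nerveOn T : SSet.{u}) ⟶ (nerveOn {z} : SSet.{u}) :=
    { app := fun m ↦ ↾fun _ ↦ ⟨nerveMk (OrderHom.const _ z), fun _ ↦ rfl⟩ }
  refine anodyneExtensions.of_deformation _ r ?_ k (nerveOnContraction T z hz k hk) ?_ ?_ ?_
  · refine NatTrans.ext (funext fun m ↦ ConcreteCategory.hom_ext _ _ fun x ↦ ?_)
    exact Subtype.ext (nerve_ext fun i ↦ (x.2 i).symm)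
  · refine NatTrans.ext (funext fun m ↦ ConcreteCategory.hom_ext _ _ fun x ↦ ?_)
    exact Subtype.ext (nerve_ext fun i ↦ if_pos rfl)
  · refine NatTrans.ext (funext fun m ↦ ConcreteCategory.hom_ext _ _ fun x ↦ ?_)
    refine Subtype.ext (nerve_ext fun i ↦ if_neg ?_)
    change k.rev ≠ k
    rcases hk with ⟨rfl, -⟩ | ⟨rfl, -⟩ <;> decide
  · refine NatTrans.ext (funext fun m ↦ ConcreteCategory.hom_ext _ _ fun x ↦ ?_)
    refine Subtype.ext (nerve_ext fun i ↦ ?_)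
    change (if _ then z else x.1.1.obj i) = x.1.1.obj i
    split_ifs
    · exact (x.1.2 i).symm
    · rfl

end Nerve

/-! ### The poset of faces and the mapping cylinder of the last vertex map. -/

/-- A nonempty finite subset of `L`. -/
structure Face (L : Type) : Type u where
  /-- The underlying finite set. -/
  carrier : Finset L
  nonempty : carrier.Nonempty

namespace Face

variable {L M : Type}

@[ext]
theorem ext {S T : Face.{u} L} (h : S.carrier = T.carrier) : S = T := by
  cases S
  cases T
  congr

instance : PartialOrder (Face.{u} L) := PartialOrder.lift carrier fun _ _ ↦ ext

instance [Finite L] : Finite (Face.{u} L) :=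
  Finite.of_injective carrier fun _ _ ↦ ext

/-- The image of a nonempty finite subset. -/
def map [DecidableEq M] (f : L → M) (S : Face.{u} L) : Face.{u} M :=
  ⟨S.carrier.image f, S.nonempty.image f⟩

theorem map_mono [DecidableEq M] (f : L → M) : Monotone (map.{u} f) :=
  fun _ _ h ↦ Finset.image_subset_image h

end Face

/-- The elements of the mapping cylinder of the map which sends a nonempty finite subset of
a linearly ordered set `L` to its greatest element. -/
inductive Cyl (L : Type) : Type u where
  | face (S : Face.{u} L)
  | vertex (i : L)

namespace Cyl

variable {L M : Type}

/-- The support of an element of the mapping cylinder. -/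
def supp (q : Cyl.{u} L) : Finset L :=
  match q with
  | face S => S.carrier
  | vertex i => {i}

theorem supp_nonempty (q : Cyl.{u} L) : q.supp.Nonempty :=
  match q with
  | face S => S.nonempty
  | vertex i => Finset.singleton_nonempty i

variable [LinearOrder L] [LinearOrder M]

/-- The order relation of the mapping cylinder. -/
protected def le (p q : Cyl.{u} L) : Prop :=
  match p, q with
  | face S, face T => S ≤ T
  | face S, vertex i => ∀ s ∈ S.carrier, s ≤ i
  | vertex i, vertex j => i ≤ j
  | vertex _, face _ => False

instance : PartialOrder (Cyl.{u} L) where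
  le := Cyl.le
  le_refl a := by
    cases a
    · exact le_refl (α := Face L) _
    · exact le_refl (α := L) _
  le_trans a b c hab hbc := by
    cases a <;> cases b <;> cases c <;> first | (exact False.elim hab) | (exact False.elim hbc) | skip
    · exact le_trans (α := Face L) hab hbc
    · exact fun s hs ↦ hbc s (hab hs)
    · exact fun s hs ↦ (hab s hs).trans hbc
    · exact le_trans (α := L) hab hbc
  le_antisymm a b hab hba := by
    cases a <;> cases b <;> first | (exact False.elim hab) | (exact False.elim hba) | skip
    · exact congrArg face (le_antisymm (α := Face L) hab hba)
    · exact congrArg vertex (le_antisymm (α := L) hab hba)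

theorem face_mono : Monotone (face : Face.{u} L → Cyl.{u} L) := fun _ _ h ↦ h

theorem vertex_mono : Monotone (vertex : L → Cyl.{u} L) := fun _ _ h ↦ h

/-- The functoriality of the mapping cylinder. -/
def map (f : L →o M) (q : Cyl.{u} L) : Cyl.{u} M :=
  match q with
  | face S => face (S.map f)
  | vertex i => vertex (f i)

theorem map_mono (f : L →o M) : Monotone (map.{u} f) := by
  intro a b hab
  cases a <;> cases b <;> first | (exact False.elim hab) | skip
  · exact Face.map_mono f hab
  · intro s hs
    obtain ⟨t, ht, rfl⟩ := Finset.mem_image.1 hs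
    exact f.monotone (hab t ht)
  · exact f.monotone hab

theorem supp_map (f : L →o M) (q : Cyl.{u} L) : (q.map f).supp = q.supp.image f := by
  cases q
  · rfl
  · exact (Finset.image_singleton _ _).symm

/-- The greatest vertex of an element of the mapping cylinder. -/
def top (q : Cyl.{u} L) : L := q.supp.max' q.supp_nonempty

theorem top_mono : Monotone (top : Cyl.{u} L → L) := by
  intro a b hab
  refine Finset.max'_le _ _ _ fun s hs ↦ ?_
  cases a <;> cases b <;> first | (exact False.elim hab) | skip
  · exact Finset.le_max' _ _ (hab hs)
  · exact (hab s hs).trans (Finset.le_max' _ _ (Finset.mem_singleton_self _))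
  · rw [Finset.mem_singleton.1 hs]
    exact le_trans (α := L) hab (Finset.le_max' _ _ (Finset.mem_singleton_self _))

/-- The elements of the mapping cylinder that are given by faces contained in `F`. -/
def facesIn (F : Finset L) : Set (Cyl.{u} L) :=
  {q | (∃ S, q = face S) ∧ q.supp ⊆ F}

/-- The mapping cylinder of a finite subset. -/
def within (F : Finset L) : Set (Cyl.{u} L) := {q | q.supp ⊆ F}

/-- The union of the nerve of the faces contained in `F` and the mapping cylinders
of the proper subsets of `F`. -/
def latching (F : Finset L) : (nerve (Cyl.{u} L)).Subcomplex :=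
  nerveOn (facesIn F) ⊔ ⨆ G ∈ F.ssubsets, nerveOn (within G)

theorem mem_latching_aux (F : Finset L) (𝓕 : Finset (Finset L)) {n : SimplexCategoryᵒᵖ}
    (s : (nerve (Cyl.{u} L)).obj n) :
    s ∈ (nerveOn (facesIn.{u} F) ⊔ ⨆ G ∈ 𝓕, nerveOn (within G)).obj n ↔
      (∀ i, s.obj i ∈ facesIn F) ∨ ∃ G ∈ 𝓕, ∀ i, s.obj i ∈ within G := by
  simp only [Subfunctor.max_obj, Subfunctor.iSup_obj, Set.mem_union, Set.mem_iUnion, mem_nerveOn,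
    exists_prop]

theorem latching_le (F : Finset L) : latching.{u} F ≤ nerveOn (within F) := by
  intro n s hs
  rcases (mem_latching_aux _ _ _).1 hs with h | ⟨G, hG, h⟩
  · exact fun i ↦ (h i).2
  · exact fun i ↦ (h i).trans (Finset.mem_ssubsets.1 hG).subset

/-- The cylinders are attached one at a time, smaller subsets before larger ones. When `G` is
attached, it meets what is already there exactly in `latching G`, so the assumption on `G` shows
that the step is anodyne. Closure of `𝓕` under proper subsets is what makes this intersection
correct. -/
theorem anodyneLE_latching_aux (F : Finset L)
    (hF : ∀ G ⊂ F, AnodyneLE (latching.{u} G) (nerveOn (within G))) (m : ℕ) :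
    ∀ 𝓕 : Finset (Finset L), 𝓕.card = m → (∀ G ∈ 𝓕, G ⊂ F) →
      (∀ G ∈ 𝓕, ∀ G', G' ⊂ G → G' ∈ 𝓕) →
      AnodyneLE (nerveOn (facesIn.{u} F))
        (nerveOn (facesIn F) ⊔ ⨆ G ∈ 𝓕, nerveOn (within G)) := by
  induction m with
  | zero =>
    intro 𝓕 h _ _
    obtain rfl := Finset.card_eq_zero.1 h
    simpa using AnodyneLE.refl _
  | succ m hm =>
    intro 𝓕 hcard h𝓕 hlow
    -- The last cylinder to be attached belongs to a maximal `G`, so that `G ∩ G'` is a proper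
    -- subset of `G` for every other `G'`.
    obtain ⟨G, hG, hmax⟩ := 𝓕.exists_maximal (Finset.card_pos.1 (by omega))
    have hmax' : ∀ G' ∈ 𝓕, G' ≠ G → ¬ G ⊆ G' := fun G' hG' hne h ↦
      hne (le_antisymm (hmax hG' h) h)
    have ih := hm (𝓕.erase G) (by rw [Finset.card_erase_of_mem hG]; omega)
      (fun G' h ↦ h𝓕 G' (Finset.mem_of_mem_erase h)) (fun G' h G'' h' ↦ by
        refine Finset.mem_erase.2 ⟨?_, hlow _ (Finset.mem_of_mem_erase h) _ h'⟩
        rintro rfl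
        exact hmax' G' (Finset.mem_of_mem_erase h) (Finset.ne_of_mem_erase h) h'.subset)
    refine ih.trans ?_
    have hinf : nerveOn (within.{u} G) ⊓
        (nerveOn (facesIn F) ⊔ ⨆ G' ∈ 𝓕.erase G, nerveOn (within G')) = latching G := by
      refine Subfunctor.ext (funext fun n ↦ Set.ext fun s ↦ ?_)
      rw [latching, mem_latching_aux, Subfunctor.min_obj, Set.mem_inter_iff, mem_latching_aux,
        mem_nerveOn]
      constructor
      · rintro ⟨h, h' | ⟨G', hG', h'⟩⟩
        · exact Or.inl fun i ↦ ⟨(h' i).1, h i⟩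
        · refine Or.inr ⟨G ∩ G', Finset.mem_ssubsets.2
            (Finset.ssubset_iff_subset_ne.2 ⟨Finset.inter_subset_left, fun h'' ↦ ?_⟩),
            fun i ↦ Finset.subset_inter (h i) (h' i)⟩
          exact hmax' G' (Finset.mem_of_mem_erase hG') (Finset.ne_of_mem_erase hG')
            (Finset.inter_eq_left.1 h'')
      · rintro (h | ⟨G', hG', h⟩)
        · exact ⟨fun i ↦ (h i).2,
            Or.inl fun i ↦ ⟨(h i).1, (h i).2.trans (h𝓕 G hG).subset⟩⟩
        · have hG'' := Finset.mem_ssubsets.1 hG'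
          exact ⟨fun i ↦ (h i).trans hG''.subset,
            Or.inr ⟨G', Finset.mem_erase.2 ⟨hG''.ne, hlow G hG G' hG''⟩, h⟩⟩
    have hsup : nerveOn (within.{u} G) ⊔
        (nerveOn (facesIn F) ⊔ ⨆ G' ∈ 𝓕.erase G, nerveOn (within G')) =
        nerveOn (facesIn F) ⊔ ⨆ G ∈ 𝓕, nerveOn (within G) := by
      conv_rhs => rw [← Finset.insert_erase hG, Finset.iSup_insert]
      rw [sup_left_comm]
    rw [← hsup]
    refine AnodyneLE.sup ?_
    rw [hinf]
    exact hF G (h𝓕 G hG)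

/-- Both sides are contractible for elementary reasons: the full face is greatest among the faces,
and the last vertex is greatest in the whole cylinder. The edge joining these two elements relates
the two base points, and right cancellation concludes. Induction on `F` enters only in passing from
the faces to the latching subcomplex. -/
theorem anodyneLE_latching (F : Finset L) : AnodyneLE (latching.{u} F) (nerveOn (within F)) := by
  induction F using Finset.strongInduction with | _ F ih
  rcases F.eq_empty_or_nonempty with rfl | hF
  · have : latching.{u} (∅ : Finset L) = nerveOn (within ∅) :=
      le_antisymm (latching_le _) fun n s hs ↦
        absurd (Finset.subset_empty.1 (hs 0)) (supp_nonempty _).ne_empty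
    rw [this]
    exact AnodyneLE.refl _
  let q₀ : Cyl.{u} L := face ⟨F, hF⟩
  let q₁ : Cyl.{u} L := vertex (F.max' hF)
  have hq : q₀ ≤ q₁ := fun s hs ↦ F.le_max' s hs
  have h₀ : AnodyneLE (nerveOn {q₀}) (latching.{u} F) := by
    refine (AnodyneLE.nerveOn_singleton (T := facesIn F) ⟨⟨_, rfl⟩, Finset.Subset.refl _⟩
      (Or.inl ?_)).trans (anodyneLE_latching_aux F ih _ F.ssubsets rfl
        (fun G hG ↦ Finset.mem_ssubsets.1 hG)
        (fun G hG G' hG' ↦ Finset.mem_ssubsets.2 (hG'.trans (Finset.mem_ssubsets.1 hG))))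
    rintro _ ⟨⟨S, rfl⟩, h⟩
    exact h
  have h₁ : AnodyneLE (nerveOn {q₁}) (nerveOn (within.{u} F)) := by
    refine AnodyneLE.nerveOn_singleton (Finset.singleton_subset_iff.2 (F.max'_mem hF)) (Or.inl ?_)
    intro t ht
    cases t with
    | face S => exact fun s hs ↦ F.le_max' s (ht hs)
    | vertex i => exact F.le_max' i (ht (Finset.mem_singleton_self i))
  have h₂ : AnodyneLE (nerveOn {q₁}) (nerveOn {q₀, q₁}) :=
    AnodyneLE.nerveOn_singleton (by simp) (Or.inl (by simpa using hq))
  have h₃ : AnodyneLE (nerveOn {q₀}) (nerveOn {q₀, q₁}) :=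
    AnodyneLE.nerveOn_singleton (by simp) (Or.inr (by simpa using hq))
  have h₄ : ({q₀, q₁} : Set (Cyl.{u} L)) ⊆ within F := by
    rintro _ (rfl | rfl)
    · exact Finset.Subset.refl F
    · exact Finset.singleton_subset_iff.2 (F.max'_mem hF)
  exact h₀.of_left (h₃.trans (h₂.of_left h₁ (nerveOn_mono h₄))) (latching_le F)

end Cyl

end SSet

/-! ### Maps out of a cosimplicial simplicial set, and boundary filling. -/

/-- Every nonempty subset of the vertices of a simplex is the image of a retraction. -/
theorem SimplexCategory.exists_retraction (n : SimplexCategory) (H : Finset (Fin (n.len + 1)))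
    (hH : H.Nonempty) : ∃ ρ : n ⟶ n, (∀ i, ρ.toOrderHom i ∈ H) ∧ ∀ i ∈ H, ρ.toOrderHom i = i := by
  -- The retraction sends `i` to the largest element of `H` that is at most `i`, or to the minimum
  -- of `H` if there is none. Replacing the elements above `i` by the minimum lets the supremum run
  -- over all of `H`.
  let g (i h : Fin (n.len + 1)) : Fin (n.len + 1) := if h ≤ i then h else H.min' hH
  have hg (i h) (hh : h ∈ H) : g i h ∈ H := by
    dsimp only [g]
    split_ifs
    · exact hh
    · exact H.min'_mem hH
  refine ⟨SimplexCategory.Hom.mk ⟨fun i ↦ H.sup' hH (g i), fun i j hij ↦ ?_⟩, fun i ↦ ?_,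
    fun i hi ↦ le_antisymm ?_ ?_⟩
  · refine Finset.sup'_mono_fun fun h hh ↦ ?_
    dsimp only [g]
    split_ifs with h1 h2 h2
    · exact le_rfl
    · exact absurd (h1.trans hij) h2
    · exact H.min'_le _ hh
    · exact le_rfl
  · obtain ⟨h, hh, heq⟩ := Finset.exists_mem_eq_sup' hH (g i)
    change H.sup' hH (g i) ∈ H
    rw [heq]
    exact hg i h hh
  · refine Finset.sup'_le hH _ fun h hh ↦ ?_
    dsimp only [g]
    split_ifs with h1
    · exact h1
    · exact H.min'_le _ hi
  · refine le_trans ?_ (Finset.le_sup' (g i) hi)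
    simp [g]

namespace SSet

/-- The simplicial set of maps from a cosimplicial simplicial set `T` to `K`. -/
def mapsFrom (T : SimplexCategory ⥤ SSet.{u}) (K : SSet.{u}) : SSet.{u} where
  obj n := T.obj n.unop ⟶ K
  map f := ↾fun w ↦ T.map f.unop ≫ w
  map_id n := by
    refine ConcreteCategory.hom_ext _ _ fun w ↦ ?_
    change T.map (𝟙 n.unop) ≫ w = w
    simp
  map_comp f g := by
    refine ConcreteCategory.hom_ext _ _ fun w ↦ ?_
    change T.map (g.unop ≫ f.unop) ≫ w = T.map g.unop ≫ T.map f.unop ≫ w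
    simp

/-- The functoriality of `mapsFrom` in the target. -/
def mapsFromPost (T : SimplexCategory ⥤ SSet.{u}) {K K' : SSet.{u}} (g : K ⟶ K') :
    mapsFrom T K ⟶ mapsFrom T K' where
  app _ := ↾fun w ↦ w ≫ g

/-- The functoriality of `mapsFrom` in the source. -/
def mapsFromPre {T T' : SimplexCategory ⥤ SSet.{u}} (a : T ⟶ T') (K : SSet.{u}) :
    mapsFrom T' K ⟶ mapsFrom T K where
  app n := ↾fun w ↦ a.app n.unop ≫ w
  naturality n m f := by
    refine ConcreteCategory.hom_ext _ _ fun w ↦ ?_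
    exact (a.naturality_assoc f.unop w).symm

/-- Every simplex of the cosimplicial simplicial set `T` is supported on a face,
i.e. it is fixed by a retraction through which all idempotents that fix the simplex factor. -/
class HasSupports (T : SimplexCategory ⥤ SSet.{u}) : Prop where
  exists_support (n : SimplexCategory) {k : SimplexCategoryᵒᵖ} (s : (T.obj n).obj k) :
    ∃ ρ : n ⟶ n, (T.map ρ).app k s = s ∧
      ∀ e : n ⟶ n, e ≫ e = e → (T.map e).app k s = s → ρ ≫ e = ρ

section Glue

variable (T : SimplexCategory ⥤ SSet.{u}) {K : SSet.{u}}

/-- The simplices of `T` that are fixed by an idempotent which is not surjective. -/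
def properPart (n : SimplexCategory) : (T.obj n).Subcomplex where
  obj k := {s | ∃ e : n ⟶ n, ¬ Function.Surjective e.toOrderHom ∧ e ≫ e = e ∧
    (T.map e).app k s = s}
  map f s := by
    rintro ⟨e, he, he', hs⟩
    refine ⟨e, he, he', ?_⟩
    rw [NatTrans.naturality_apply, hs]

variable {T}

/-- The simplex of `∂Δ[n]` given by a map that is not surjective. -/
def boundaryMk {n : ℕ} {m : SimplexCategory} (x : m ⟶ ⦋n⦌)
    (hx : ¬ Function.Surjective x.toOrderHom) : (∂Δ[n] : SSet.{u}).obj (op m) :=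
  ⟨stdSimplex.objEquiv.symm x, hx⟩

/-- The evaluation of a morphism `∂Δ[n] ⟶ mapsFrom T K` at a simplex of `∂Δ[n]`. -/
def evalBoundary {n : ℕ} (t : (∂Δ[n] : SSet.{u}) ⟶ mapsFrom T K) {m : SimplexCategory}
    (x : m ⟶ ⦋n⦌) (hx : ¬ Function.Surjective x.toOrderHom) : T.obj m ⟶ K :=
  t.app (op m) (boundaryMk x hx)

theorem evalBoundary_comp {n : ℕ} (t : (∂Δ[n] : SSet.{u}) ⟶ mapsFrom T K) {m m' : SimplexCategory}
    (f : m' ⟶ m) (x : m ⟶ ⦋n⦌) (hx : ¬ Function.Surjective x.toOrderHom)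
    (hx' : ¬ Function.Surjective (f ≫ x).toOrderHom) :
    evalBoundary t (f ≫ x) hx' = T.map f ≫ evalBoundary t x hx :=
  NatTrans.naturality_apply t f.op (boundaryMk x hx)

theorem evalBoundary_congr {n : ℕ} (t : (∂Δ[n] : SSet.{u}) ⟶ mapsFrom T K) {m : SimplexCategory}
    {x x' : m ⟶ ⦋n⦌} (h : x = x') (hx : ¬ Function.Surjective x.toOrderHom) :
    evalBoundary t x hx = evalBoundary t x' (h ▸ hx) := by
  subst h
  rfl

theorem evalBoundary_app_eq {n : ℕ} (t : (∂Δ[n] : SSet.{u}) ⟶ mapsFrom T K)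
    {m : SimplexCategory} (x : m ⟶ ⦋n⦌) (hx : ¬ Function.Surjective x.toOrderHom)
    (e : ⦋n⦌ ⟶ ⦋n⦌) (he : ¬ Function.Surjective e.toOrderHom) (h : x ≫ e = x)
    {k : SimplexCategoryᵒᵖ} (s : (T.obj m).obj k) :
    (evalBoundary t e he).app k ((T.map x).app k s) = (evalBoundary t x hx).app k s := by
  have h' : ¬ Function.Surjective (x ≫ e).toOrderHom := by rwa [h]
  have := evalBoundary_comp t x e he h'
  rw [evalBoundary_congr t h h'] at this
  rw [this]
  rfl

/-- Well-definedness of the map on the proper part: the values obtained from two idempotents both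
agree with the value obtained from the support `ρ`, through which both factor. -/
theorem evalBoundary_app_eq_of_fixed [HasSupports T] {n : ℕ}
    (t : (∂Δ[n] : SSet.{u}) ⟶ mapsFrom T K) {k : SimplexCategoryᵒᵖ} (s : (T.obj ⦋n⦌).obj k)
    (e e' : ⦋n⦌ ⟶ ⦋n⦌) (he : ¬ Function.Surjective e.toOrderHom)
    (he' : ¬ Function.Surjective e'.toOrderHom) (h : e ≫ e = e) (h' : e' ≫ e' = e')
    (hs : (T.map e).app k s = s) (hs' : (T.map e').app k s = s) :
    (evalBoundary t e he).app k s = (evalBoundary t e' he').app k s := by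
  obtain ⟨ρ, h1, h2⟩ := HasSupports.exists_support (T := T) ⦋n⦌ s
  -- If `ρ` were surjective, `ρ ≫ e = ρ` would force `e` to be surjective.
  have hρ : ¬ Function.Surjective ρ.toOrderHom := fun hρ ↦ he (by
    rw [← h2 e h hs] at hρ
    exact Function.Surjective.of_comp hρ)
  have key := evalBoundary_app_eq t ρ hρ e he (h2 e h hs) s
  have key' := evalBoundary_app_eq t ρ hρ e' he' (h2 e' h' hs') s
  rw [h1] at key key'
  exact key.trans key'.symm

/-- The morphism to `K` on the proper part of `T` given by a morphism `∂Δ[n] ⟶ mapsFrom T K`. -/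
noncomputable def properDesc [HasSupports T] {n : ℕ} (t : (∂Δ[n] : SSet.{u}) ⟶ mapsFrom T K) :
    (properPart T ⦋n⦌ : SSet.{u}) ⟶ K where
  app k := ↾fun s ↦ (evalBoundary t s.2.choose s.2.choose_spec.1).app k s.1
  naturality k k' f := by
    refine ConcreteCategory.hom_ext _ _ fun s ↦ ?_
    let s' : (properPart T ⦋n⦌ : SSet.{u}).obj k' := (properPart T ⦋n⦌ : SSet.{u}).map f s
    change (evalBoundary t s'.2.choose s'.2.choose_spec.1).app k' ((T.obj ⦋n⦌).map f s.1) =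
      K.map f ((evalBoundary t s.2.choose s.2.choose_spec.1).app k s.1)
    have h := s.2.choose_spec
    have h' := s'.2.choose_spec
    rw [← NatTrans.naturality_apply]
    refine evalBoundary_app_eq_of_fixed t _ _ _ _ _ h'.2.1 h.2.1 h'.2.2 ?_
    rw [NatTrans.naturality_apply, h.2.2]

theorem properDesc_app [HasSupports T] {n : ℕ} (t : (∂Δ[n] : SSet.{u}) ⟶ mapsFrom T K)
    {k : SimplexCategoryᵒᵖ} (s : (properPart T ⦋n⦌ : SSet.{u}).obj k)
    (e : ⦋n⦌ ⟶ ⦋n⦌) (he : ¬ Function.Surjective e.toOrderHom) (h : e ≫ e = e)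
    (hs : (T.map e).app k s.1 = s.1) :
    (properDesc t).app k s = (evalBoundary t e he).app k s.1 :=
  evalBoundary_app_eq_of_fixed t _ _ _ _ _ s.2.choose_spec.2.1 h s.2.choose_spec.2.2 hs

/-- Take a retraction onto the image of `x`. -/
theorem exists_idempotent {m : SimplexCategory} {n : SimplexCategory} (x : m ⟶ n)
    (hx : ¬ Function.Surjective x.toOrderHom) :
    ∃ e : n ⟶ n, ¬ Function.Surjective e.toOrderHom ∧ e ≫ e = e ∧ x ≫ e = x := by
  obtain ⟨ρ, h1, h2⟩ := n.exists_retraction (Finset.univ.image x.toOrderHom)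
    (Finset.univ_nonempty.image _)
  refine ⟨ρ, fun hρ ↦ hx fun i ↦ ?_, ?_, ?_⟩
  · obtain ⟨j, rfl⟩ := hρ i
    simpa using h1 j
  · exact SimplexCategory.Hom.ext _ _ (OrderHom.ext _ _ (funext fun i ↦ h2 _ (h1 i)))
  · exact SimplexCategory.Hom.ext _ _ (OrderHom.ext _ _ (funext fun i ↦ h2 _ (by simp)))

/-- This reduces filling a boundary in `mapsFrom T K` to extending one morphism from the proper part
of `T` to all of `T.obj ⦋n⦌`. -/
theorem boundary_ι_comp_yonedaEquiv_symm [HasSupports T] {n : ℕ}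
    (t : (∂Δ[n] : SSet.{u}) ⟶ mapsFrom T K) (w : T.obj ⦋n⦌ ⟶ K)
    (hw : (properPart T ⦋n⦌).ι ≫ w = properDesc t) :
    ∂Δ[n].ι ≫ yonedaEquiv.symm (show (mapsFrom T K).obj (op ⦋n⦌) from w) = t := by
  refine NatTrans.ext (funext fun m ↦ ConcreteCategory.hom_ext _ _ fun x ↦ ?_)
  obtain ⟨x, hx⟩ := x
  obtain ⟨x, rfl⟩ := stdSimplex.objEquiv.symm.surjective x
  change T.map x ≫ w = evalBoundary t x hx
  obtain ⟨e, he, he', hxe⟩ := exists_idempotent x hx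
  refine NatTrans.ext (funext fun k ↦ ConcreteCategory.hom_ext _ _ fun s ↦ ?_)
  have hs : (T.map e).app k ((T.map x).app k s) = (T.map x).app k s := by
    conv_rhs => rw [← hxe, Functor.map_comp]
    rfl
  let s' : (properPart T ⦋n⦌ : SSet.{u}).obj k := ⟨(T.map x).app k s, e, he, he', hs⟩
  have h1 := ConcreteCategory.congr_hom (NatTrans.congr_app hw k) s'
  rw [properDesc_app t s' e he he' hs, evalBoundary_app_eq t x hx e he hxe] at h1
  exact h1

end Glue

/-! ### Cones on posets, and the subdivision and cylinder cosimplicial objects. -/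

section Cone

theorem ite_zero_one_eq_zero_iff (P : Prop) [Decidable P] :
    (if P then (0 : Fin 2) else 1) = 0 ↔ P := by
  split_ifs with h <;> simp [h]

variable {Q : Type u} [PartialOrder Q] (p : Q → Prop) (hp : ∀ a b, a ≤ b → p b → p a)

open scoped Classical in
/-- The morphism from the nerve of `Q` to the cone on the nerve of a lower set of `Q`, which sends
all other elements of `Q` to the vertex of the cone. -/
noncomputable def nerveToJoin : nerve Q ⟶ join (nerve {q : Q // p q}) Δ[0] where
  app n := ↾fun s ↦
    { cut := SimplexCategory.Hom.mk
        { toFun := fun i ↦ if p (s.obj i) then (0 : Fin 2) else 1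
          monotone' := fun i j hij ↦ by
            dsimp only
            split_ifs with h1 h2
            · exact le_rfl
            · exact Fin.zero_le _
            · exact absurd (hp _ _ (nerve_monotone s hij) (by assumption)) h1
            · exact le_rfl }
      left := fun m φ h ↦ nerveMk
        { toFun := fun i ↦ ⟨s.obj (φ.toOrderHom i), (ite_zero_one_eq_zero_iff _).1 (h i)⟩
          monotone' := fun i j hij ↦ nerve_monotone s (φ.toOrderHom.monotone hij) }
      left_map := fun m m' ψ φ h h' ↦ nerve_ext fun i ↦ rfl
      right := fun m φ h ↦ stdSimplex.objEquiv.symm (SimplexCategory.const m ⦋0⦌ 0)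
      right_map := fun m m' ψ φ h h' ↦ rfl }
  naturality n m f := rfl

theorem nerveMap_comp_nerveToJoin :
    nerveMap (Subtype.mono_coe p).functor ≫ nerveToJoin p hp =
      joinInl (nerve {q : Q // p q}) Δ[0] := by
  refine NatTrans.ext (funext fun n ↦ ConcreteCategory.hom_ext _ _ fun s ↦ ?_)
  refine JoinSimplex.ext' ?_ ?_ ?_
  · exact SimplexCategory.Hom.ext _ _ (OrderHom.ext _ _ (funext fun i ↦ if_pos (s.obj i).2))
  · intro m φ h h'
    rfl
  · intro m φ h h'
    exact absurd (show (0 : Fin 2) = 1 from h' 0) (by decide)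

end Cone

theorem Face.map_map {L M N : Type} [DecidableEq M] [DecidableEq N] (f : L → M) (g : M → N)
    (S : Face.{u} L) : S.map (g ∘ f) = (S.map f).map g :=
  Face.ext Finset.image_image.symm

/-- The cosimplicial simplicial set given by the barycentric subdivisions of the simplices. -/
def faceCosimplicial : SimplexCategory ⥤ SSet.{u} where
  obj n := nerve (Face.{u} (Fin (n.len + 1)))
  map f := nerveMap (Face.map_mono f.toOrderHom).functor
  map_id n := by
    refine NatTrans.ext (funext fun k ↦ ConcreteCategory.hom_ext _ _ fun s ↦ nerve_ext fun i ↦ ?_)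
    exact Face.ext Finset.image_id
  map_comp f g := by
    refine NatTrans.ext (funext fun k ↦ ConcreteCategory.hom_ext _ _ fun s ↦ nerve_ext fun i ↦ ?_)
    exact Face.map_map f.toOrderHom g.toOrderHom _

/-- The cosimplicial simplicial set given by the mapping cylinders of the last vertex maps from the
barycentric subdivisions of the simplices to the simplices. -/
def cylCosimplicial : SimplexCategory ⥤ SSet.{u} where
  obj n := nerve (Cyl.{u} (Fin (n.len + 1)))
  map f := nerveMap (Cyl.map_mono f.toOrderHom).functor
  map_id n := by
    refine NatTrans.ext (funext fun k ↦ ConcreteCategory.hom_ext _ _ fun s ↦ nerve_ext fun i ↦ ?_)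
    change Cyl.map OrderHom.id (s.obj i) = s.obj i
    cases s.obj i
    · exact congrArg Cyl.face (Face.ext Finset.image_id)
    · rfl
  map_comp f g := by
    refine NatTrans.ext (funext fun k ↦ ConcreteCategory.hom_ext _ _ fun s ↦ nerve_ext fun i ↦ ?_)
    change Cyl.map (g.toOrderHom.comp f.toOrderHom) (s.obj i) =
      Cyl.map g.toOrderHom (Cyl.map f.toOrderHom (s.obj i))
    cases s.obj i
    · exact congrArg Cyl.face (Face.map_map f.toOrderHom g.toOrderHom _)
    · rfl

/-- The inclusion of the barycentric subdivision in the mapping cylinder. -/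
def faceToCyl : faceCosimplicial.{u} ⟶ cylCosimplicial where
  app n := nerveMap (Cyl.face_mono (L := Fin (n.len + 1))).functor

theorem Cyl.map_eq_self {L : Type} [LinearOrder L] (f : L →o L) (q : Cyl.{u} L)
    (h : ∀ i ∈ q.supp, f i = i) : q.map f = q := by
  have key : q.supp.image f = q.supp := by
    ext i
    rw [Finset.mem_image]
    constructor
    · rintro ⟨j, hj, rfl⟩
      rwa [h j hj]
    · exact fun hi ↦ ⟨i, hi, h i hi⟩
  cases q with
  | face S => exact congrArg face (Face.ext key)
  | vertex i => exact congrArg vertex (h i (Finset.mem_singleton_self i))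

theorem Cyl.apply_eq_self {L : Type} [LinearOrder L] (f : L →o L) (hf : ∀ i, f (f i) = f i)
    (q : Cyl.{u} L) (h : q.map f = q) (i : L) (hi : i ∈ q.supp) : f i = i := by
  rw [← h, Cyl.supp_map] at hi
  obtain ⟨j, -, rfl⟩ := Finset.mem_image.1 hi
  exact hf j

theorem apply_apply_of_idempotent {n : SimplexCategory} {e : n ⟶ n} (h : e ≫ e = e) (i) :
    e.toOrderHom (e.toOrderHom i) = e.toOrderHom i :=
  congrArg (fun e : n ⟶ n ↦ e.toOrderHom i) h

instance : HasSupports cylCosimplicial.{u} where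
  exists_support n k s := by
    change (nerve (Cyl.{u} (Fin (n.len + 1)))).obj k at s
    obtain ⟨ρ, h1, h2⟩ := n.exists_retraction
      (Finset.univ.biUnion fun i ↦ (s.obj i).supp)
      (Finset.biUnion_nonempty.2 ⟨0, Finset.mem_univ _, Cyl.supp_nonempty _⟩)
    refine ⟨ρ, nerve_ext fun i ↦ Cyl.map_eq_self _ _ fun j hj ↦
      h2 j (Finset.mem_biUnion.2 ⟨i, Finset.mem_univ _, hj⟩), fun e he hs ↦ ?_⟩
    refine SimplexCategory.Hom.ext _ _ (OrderHom.ext _ _ (funext fun i ↦ ?_))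
    obtain ⟨j, -, hj⟩ := Finset.mem_biUnion.1 (h1 i)
    exact Cyl.apply_eq_self e.toOrderHom (apply_apply_of_idempotent he) (s.obj j)
      (congrArg (fun s : (nerve (Cyl.{u} (Fin (n.len + 1)))).obj k ↦ s.obj j) hs) _ hj

theorem faceToCyl_app_injective (n : SimplexCategory) {k : SimplexCategoryᵒᵖ}
    {s s' : (faceCosimplicial.{u}.obj n).obj k}
    (h : (faceToCyl.app n).app k s = (faceToCyl.app n).app k s') : s = s' := by
  change (nerve (Face.{u} (Fin (n.len + 1)))).obj k at s s'
  refine nerve_ext fun i ↦ Cyl.face.inj ?_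
  exact congrArg (fun s : (nerve (Cyl.{u} (Fin (n.len + 1)))).obj k ↦ s.obj i) h

theorem faceToCyl_naturality_apply {n m : SimplexCategory} (f : n ⟶ m) {k : SimplexCategoryᵒᵖ}
    (s : (faceCosimplicial.{u}.obj n).obj k) :
    (faceToCyl.app m).app k ((faceCosimplicial.map f).app k s) =
      (cylCosimplicial.map f).app k ((faceToCyl.app n).app k s) := rfl

instance : HasSupports faceCosimplicial.{u} where
  exists_support n k s := by
    obtain ⟨ρ, h1, h2⟩ := HasSupports.exists_support (T := cylCosimplicial) n
      ((faceToCyl.app n).app k s)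
    refine ⟨ρ, faceToCyl_app_injective n h1, fun e he hs ↦ h2 e he ?_⟩
    rw [← faceToCyl_naturality_apply, hs]

/-- The image of an idempotent serves as `G`; conversely a retraction onto `G` is an idempotent
fixing the simplex. -/
theorem mem_properPart_cylCosimplicial_iff (n : SimplexCategory) {k : SimplexCategoryᵒᵖ}
    (s : (nerve (Cyl.{u} (Fin (n.len + 1)))).obj k) :
    s ∈ (properPart cylCosimplicial.{u} n).obj k ↔
      ∃ G : Finset (Fin (n.len + 1)), G ≠ Finset.univ ∧ ∀ i, (s.obj i).supp ⊆ G := by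
  constructor
  · rintro ⟨e, he, he', hs⟩
    refine ⟨Finset.univ.image e.toOrderHom, fun h ↦ he fun i ↦ ?_, fun i j hj ↦ ?_⟩
    · have := h ▸ Finset.mem_univ i
      simpa using this
    · rw [← Cyl.apply_eq_self e.toOrderHom (apply_apply_of_idempotent he') (s.obj i)
        (congrArg (fun s : (nerve (Cyl.{u} (Fin (n.len + 1)))).obj k ↦ s.obj i) hs) j hj]
      exact Finset.mem_image_of_mem _ (Finset.mem_univ _)
  · rintro ⟨G, hG, hs⟩
    obtain ⟨ρ, h1, h2⟩ := n.exists_retraction G ((Cyl.supp_nonempty (s.obj 0)).mono (hs 0))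
    refine ⟨ρ, fun hρ ↦ hG (Finset.eq_univ_of_forall fun i ↦ ?_), ?_, ?_⟩
    · obtain ⟨j, rfl⟩ := hρ i
      exact h1 j
    · exact SimplexCategory.Hom.ext _ _ (OrderHom.ext _ _ (funext fun i ↦ h2 _ (h1 i)))
    · exact nerve_ext fun i ↦ Cyl.map_eq_self _ _ fun j hj ↦ h2 j (hs i hj)

theorem faceToCyl_app_mem_properPart_iff (n : SimplexCategory) {k : SimplexCategoryᵒᵖ}
    (s : (faceCosimplicial.{u}.obj n).obj k) :
    (faceToCyl.app n).app k s ∈ (properPart cylCosimplicial.{u} n).obj k ↔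
      s ∈ (properPart faceCosimplicial.{u} n).obj k := by
  refine exists_congr fun e ↦ and_congr_right fun _ ↦ and_congr_right fun _ ↦ ?_
  rw [← faceToCyl_naturality_apply]
  exact ⟨fun h ↦ faceToCyl_app_injective n h, fun h ↦ congrArg _ h⟩

/-- The faces form a chain, so the last one contains all the others and serves as the common proper
subset. -/
theorem mem_properPart_faceCosimplicial_iff (n : SimplexCategory) {k : SimplexCategoryᵒᵖ}
    (s : (nerve (Face.{u} (Fin (n.len + 1)))).obj k) :
    s ∈ (properPart faceCosimplicial.{u} n).obj k ↔
      ∀ i, (s.obj i).carrier ≠ Finset.univ := by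
  refine (faceToCyl_app_mem_properPart_iff n s).symm.trans ?_
  refine (mem_properPart_cylCosimplicial_iff n _).trans ?_
  constructor
  · rintro ⟨G, hG, h⟩ i hi
    refine hG (Finset.eq_univ_of_forall fun j ↦ h i ?_)
    change j ∈ (s.obj i).carrier
    rw [hi]
    exact Finset.mem_univ j
  · exact fun h ↦ ⟨(s.obj (Fin.last _)).carrier, h _, fun i ↦ nerve_monotone s (Fin.le_last i)⟩

/-- If maps from nerves of finite partially ordered sets to `C` extend to cones, then maps from
boundaries of simplices to `mapsFrom faceCosimplicial C` extend to simplices. -/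
theorem exists_extension_mapsFrom_faceCosimplicial (C : SSet.{u})
    (hext : ∀ (P : Type u) [PartialOrder P] [Finite P] (f : nerve P ⟶ C),
      ∃ g : SSet.join (nerve P) Δ[0] ⟶ C, SSet.joinInl (nerve P) Δ[0] ≫ g = f) (n : ℕ)
    (t : (∂Δ[n] : SSet.{u}) ⟶ mapsFrom faceCosimplicial C) :
    ∃ l : Δ[n] ⟶ mapsFrom faceCosimplicial C, ∂Δ[n].ι ≫ l = t := by
  let p (S : Face.{u} (Fin (n + 1))) : Prop := S.carrier ≠ Finset.univ
  have hp : ∀ S T, S ≤ T → p T → p S := fun S T h hT hS ↦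
    hT (Finset.univ_subset_iff.1 (hS ▸ h))
  let i : nerve {S // p S} ⟶ (properPart faceCosimplicial.{u} ⦋n⦌ : SSet.{u}) :=
    Subcomplex.lift (nerveMap (Subtype.mono_coe p).functor) (by
      rintro k _ ⟨s, rfl⟩
      exact (mem_properPart_faceCosimplicial_iff ⦋n⦌ _).2 fun i ↦ (s.obj i).2)
  -- The full face is the only one that is not proper, and `nerveToJoin` sends it to the cone point.
  -- For `n = 0` the poset of proper faces is empty.
  obtain ⟨g, hg⟩ := hext {S // p S} (i ≫ properDesc t)
  refine ⟨_, boundary_ι_comp_yonedaEquiv_symm t (nerveToJoin p hp ≫ g) ?_⟩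
  refine NatTrans.ext (funext fun k ↦ ConcreteCategory.hom_ext _ _ fun s ↦ ?_)
  have hs := (mem_properPart_faceCosimplicial_iff ⦋n⦌ _).1 s.2
  let s' : (nerve {S // p S}).obj k := nerveMk ⟨fun j ↦ ⟨_, hs j⟩, fun j j' h ↦
    nerve_monotone s.1 h⟩
  rw [← nerveMap_comp_nerveToJoin p hp] at hg
  exact ConcreteCategory.congr_hom (NatTrans.congr_app hg k) s'

open HomotopicalAlgebra modelCategoryQuillen

/-! ### Restriction from cylinders to subdivisions is a trivial fibration. -/

section Lifting

theorem AnodyneLE.exists_extension {X K : SSet.{u}} [KanComplex K] {A : X.Subcomplex}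
    (hA : AnodyneLE A ⊤) (f : (A : SSet.{u}) ⟶ K) : ∃ w : X ⟶ K, A.ι ≫ w = f := by
  obtain ⟨h, hA⟩ := hA
  have := hA (Limits.terminal.from K)
    ((modelCategoryQuillen.fibration_iff _).1 ((isFibrant_iff K).1 inferInstance))
  have sq : CommSq f (Subcomplex.homOfLE h) (Limits.terminal.from K)
    (Limits.terminal.from _) := ⟨by simp⟩
  exact ⟨(Subcomplex.topIso X).inv ≫ sq.lift, sq.fac_left⟩

theorem latching_univ_eq (n : ℕ) :
    Cyl.latching.{u} (Finset.univ : Finset (Fin (n + 1))) =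
      nerveOn (Cyl.facesIn Finset.univ) ⊔ properPart cylCosimplicial.{u} ⦋n⦌ := by
  refine Subfunctor.ext (funext fun k ↦ Set.ext fun s ↦ ?_)
  change _ ↔ (∀ i, s.obj i ∈ Cyl.facesIn.{u} (Finset.univ : Finset (Fin (n + 1)))) ∨
    s ∈ (properPart cylCosimplicial.{u} ⦋n⦌).obj k
  rw [Cyl.latching, Cyl.mem_latching_aux]
  refine or_congr_right ((mem_properPart_cylCosimplicial_iff ⦋n⦌ s).trans ?_).symm
  simp only [Finset.mem_ssubsets, Finset.ssubset_univ_iff]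
  rfl

/-- The simplex of the barycentric subdivision given by a simplex of the mapping cylinder
all of whose vertices are faces. -/
def Cyl.toFaces (n : ℕ) : (nerveOn (Cyl.facesIn.{u} (Finset.univ : Finset (Fin (n + 1)))) :
    SSet.{u}) ⟶ faceCosimplicial.{u}.obj ⦋n⦌ where
  app k := ↾fun s ↦ nerveMk
    { toFun := fun i ↦ ⟨(s.1.obj i).supp, Cyl.supp_nonempty _⟩
      monotone' := fun i j hij ↦ by
        have h := nerve_monotone s.1 hij
        obtain ⟨S, hS⟩ := (s.2 i).1
        obtain ⟨T, hT⟩ := (s.2 j).1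
        change (s.1.obj i).supp ⊆ (s.1.obj j).supp
        rw [hS, hT] at h ⊢
        exact h }

theorem Cyl.toFaces_comp (n : ℕ) :
    Cyl.toFaces.{u} n ≫ faceToCyl.app ⦋n⦌ = (nerveOn (Cyl.facesIn Finset.univ)).ι := by
  refine NatTrans.ext (funext fun k ↦ ConcreteCategory.hom_ext _ _ fun s ↦ nerve_ext fun i ↦ ?_)
  obtain ⟨S, hS⟩ := (s.2 i).1
  change Cyl.face ⟨(s.1.obj i).supp, _⟩ = s.1.obj i
  simp only [hS]
  rfl

/-- For a Kan complex `K`, the restriction from mapping cylinders to barycentric subdivisions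
has the right lifting property with respect to boundary inclusions. -/
theorem exists_lift_mapsFromPre (K : SSet.{u}) [KanComplex K] (n : ℕ)
    (t : (∂Δ[n] : SSet.{u}) ⟶ mapsFrom cylCosimplicial K)
    (b : Δ[n] ⟶ mapsFrom faceCosimplicial K)
    (h : t ≫ mapsFromPre faceToCyl K = ∂Δ[n].ι ≫ b) :
    ∃ l : Δ[n] ⟶ mapsFrom cylCosimplicial K,
      ∂Δ[n].ι ≫ l = t ∧ l ≫ mapsFromPre faceToCyl K = b := by
  obtain ⟨w, rfl⟩ := yonedaEquiv.symm.surjective b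
  change faceCosimplicial.obj ⦋n⦌ ⟶ K at w
  let R : (nerve (Cyl.{u} (Fin (n + 1)))).Subcomplex := nerveOn (Cyl.facesIn Finset.univ)
  let D : (nerve (Cyl.{u} (Fin (n + 1)))).Subcomplex := properPart cylCosimplicial.{u} ⦋n⦌
  have sq : Subcomplex.BicartSq (R ⊓ D) R D (R ⊔ D) := ⟨rfl, rfl⟩
  -- The prescribed maps on the faces and on the proper part agree on the overlap: a simplex there
  -- is fixed by some non-surjective idempotent `e`, and `h` evaluated at `e` compares the two.
  have key : Subcomplex.homOfLE sq.le₁₂ ≫ Cyl.toFaces n ≫ w =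
      Subcomplex.homOfLE sq.le₁₃ ≫ properDesc t := by
    refine NatTrans.ext (funext fun k ↦ ConcreteCategory.hom_ext _ _ fun s ↦ ?_)
    let s₁ : (R : SSet.{u}).obj k := ⟨s.1, s.2.1⟩
    let s₂ : (D : SSet.{u}).obj k := ⟨s.1, s.2.2⟩
    let s' := (Cyl.toFaces n).app k s₁
    have hs' : (faceToCyl.app ⦋n⦌).app k s' = s.1 :=
      ConcreteCategory.congr_hom (NatTrans.congr_app (Cyl.toFaces_comp n) k) s₁
    obtain ⟨e, he, he', hs⟩ := s.2.2
    change w.app k s' = (properDesc t).app k s₂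
    rw [properDesc_app t s₂ e he he' hs]
    have h1 : faceToCyl.app ⦋n⦌ ≫ evalBoundary t e he = faceCosimplicial.map e ≫ w :=
      ConcreteCategory.congr_hom (NatTrans.congr_app h (op ⦋n⦌)) (boundaryMk e he)
    have h2 := ConcreteCategory.congr_hom (NatTrans.congr_app h1 k) s'
    have h3 : (faceCosimplicial.map e).app k s' = s' := by
      refine faceToCyl_app_injective _ ?_
      rw [faceToCyl_naturality_apply, hs']
      exact hs
    change (evalBoundary t e he).app k ((faceToCyl.app ⦋n⦌).app k s') =
      w.app k ((faceCosimplicial.map e).app k s') at h2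
    rw [h3, hs'] at h2
    exact h2.symm
  -- For the full vertex set, the latching subcomplex is `R ⊔ D` and the cylinder is everything.
  have hA : AnodyneLE (R ⊔ D) ⊤ := by
    have := Cyl.anodyneLE_latching.{u} (Finset.univ : Finset (Fin (n + 1)))
    rw [latching_univ_eq] at this
    convert this
    exact (top_unique fun k s _ i ↦ Finset.subset_univ _).symm
  obtain ⟨v, hv⟩ := hA.exists_extension (sq.isPushout.desc _ _ key)
  have hv₁ : R.ι ≫ v = Cyl.toFaces n ≫ w := by
    rw [← sq.isPushout.inl_desc _ _ key, ← hv]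
    rfl
  have hv₂ : D.ι ≫ v = properDesc t := by
    rw [← sq.isPushout.inr_desc _ _ key, ← hv]
    rfl
  refine ⟨_, boundary_ι_comp_yonedaEquiv_symm t v hv₂, ?_⟩
  refine yonedaEquiv.injective ?_
  have h4 : faceToCyl.app ⦋n⦌ ≫ v = w := by
    refine NatTrans.ext (funext fun k ↦ ConcreteCategory.hom_ext _ _ fun s ↦ ?_)
    change (nerve (Face.{u} (Fin (n + 1)))).obj k at s
    let s' : (R : SSet.{u}).obj k := ⟨(faceToCyl.app ⦋n⦌).app k s,
      fun i ↦ ⟨⟨s.obj i, rfl⟩, Finset.subset_univ _⟩⟩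
    exact ConcreteCategory.congr_hom (NatTrans.congr_app hv₁ k) s'
  refine (yonedaEquiv_comp _ _).trans ?_
  refine Eq.trans ?_ (yonedaEquiv.apply_symm_apply _).symm
  refine (congrArg ((mapsFromPre faceToCyl K).app (op ⦋n⦌))
    (yonedaEquiv.apply_symm_apply _)).trans ?_
  exact h4

end Lifting

end SSet

/-! ### Singular simplicial sets are Kan complexes. -/

theorem stdSimplex.map_eq_self {ι : Type*} [Fintype ι] (f : ι → ι) (p : stdSimplex ℝ ι)
    (h : ∀ x, p x ≠ 0 → f x = x) : stdSimplex.map f p = p := by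
  classical
  refine stdSimplex.ext (funext fun y ↦ ?_)
  rw [stdSimplex.map_coe, FunOnFinite.linearMap_apply_apply]
  refine Finset.sum_eq_single y (fun x hx hxy ↦ ?_) fun hy ↦ ?_
  · by_contra h0
    exact hxy ((h x h0).symm.trans (Finset.mem_filter.1 hx).2)
  · by_contra h0
    exact hy (Finset.mem_filter.2 ⟨Finset.mem_univ _, h y h0⟩)

theorem stdSimplex.map_apply_eq_zero {ι κ : Type*} [Fintype ι] [Fintype κ] (f : ι → κ)
    (p : stdSimplex ℝ ι) (y : κ) (h : ∀ x, f x ≠ y) : stdSimplex.map f p y = 0 := by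
  classical
  rw [stdSimplex.map_coe, FunOnFinite.linearMap_apply_apply]
  exact Finset.sum_eq_zero fun x hx ↦ absurd (Finset.mem_filter.1 hx).2 (h x)

section HornRetraction

variable {n : ℕ} (i : Fin (n + 2))

theorem univ_erase_nonempty : ((Finset.univ : Finset (Fin (n + 2))).erase i).Nonempty := by
  rw [← Finset.card_pos, Finset.card_erase_of_mem (Finset.mem_univ _)]
  simp

/-- The minimum of the barycentric coordinates other than the `i`th one. -/
noncomputable def minCoord (p : stdSimplex ℝ (Fin (n + 2))) : ℝ :=
  (Finset.univ.erase i).inf' (univ_erase_nonempty i) fun j ↦ p j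

theorem minCoord_nonneg (p : stdSimplex ℝ (Fin (n + 2))) : 0 ≤ minCoord i p :=
  Finset.le_inf' _ _ fun j _ ↦ p.2.1 j

theorem minCoord_le (p : stdSimplex ℝ (Fin (n + 2))) {j : Fin (n + 2)} (hj : j ≠ i) :
    minCoord i p ≤ p j :=
  Finset.inf'_le _ (Finset.mem_erase.2 ⟨hj, Finset.mem_univ _⟩)

theorem exists_eq_minCoord (p : stdSimplex ℝ (Fin (n + 2))) : ∃ j, j ≠ i ∧ p j = minCoord i p := by
  obtain ⟨j, hj, h⟩ := Finset.exists_mem_eq_inf' (univ_erase_nonempty i) fun j ↦ p j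
  exact ⟨j, Finset.ne_of_mem_erase hj, h.symm⟩

theorem continuous_minCoord : Continuous (minCoord i) :=
  Continuous.finset_inf'_apply _ fun j _ ↦ (continuous_apply j).comp continuous_subtype_val

/-- The retraction of the topological simplex to the `i`th horn. -/
noncomputable def hornRetraction (p : stdSimplex ℝ (Fin (n + 2))) :
    stdSimplex ℝ (Fin (n + 2)) :=
  ⟨fun k ↦ p k - minCoord i p + if k = i then (n + 2) * minCoord i p else 0, by
    -- The minimum is subtracted from all `n + 2` coordinates, the `i`th included, so giving back `n
    -- + 2` times the minimum at `i` keeps the sum equal to 1.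
    have h0 := minCoord_nonneg i p
    refine ⟨fun k ↦ ?_, ?_⟩
    · dsimp only
      split_ifs with hk
      · have := p.2.1 k
        change 0 ≤ p k at this
        nlinarith [(Nat.cast_nonneg n : (0 : ℝ) ≤ n)]
      · have := minCoord_le i p hk
        linarith
    · rw [Finset.sum_add_distrib, Finset.sum_sub_distrib, stdSimplex.sum_eq_one]
      simp⟩

theorem continuous_hornRetraction : Continuous (hornRetraction i) := by
  refine Continuous.subtype_mk (continuous_pi fun k ↦ ?_) _
  have h1 := continuous_minCoord i
  have h2 : Continuous fun p : stdSimplex ℝ (Fin (n + 2)) ↦ p k :=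
    (continuous_apply k).comp continuous_subtype_val
  split_ifs
  · exact (h2.sub h1).add (continuous_const.mul h1)
  · exact (h2.sub h1).add continuous_const

theorem hornRetraction_apply_eq_zero (p : stdSimplex ℝ (Fin (n + 2))) {j : Fin (n + 2)}
    (hj : j ≠ i) (h : p j = minCoord i p) : hornRetraction i p j = 0 := by
  change p j - minCoord i p + (if j = i then _ else _) = 0
  rw [if_neg hj, h]
  simp

theorem minCoord_eq_zero (p : stdSimplex ℝ (Fin (n + 2))) {j : Fin (n + 2)}
    (hj : j ≠ i) (h : p j = 0) : minCoord i p = 0 :=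
  le_antisymm (h ▸ minCoord_le i p hj) (minCoord_nonneg i p)

theorem hornRetraction_eq_self (p : stdSimplex ℝ (Fin (n + 2))) (h : minCoord i p = 0) :
    hornRetraction i p = p := by
  refine stdSimplex.ext (funext fun k ↦ ?_)
  change p k - minCoord i p + (if k = i then (n + 2) * minCoord i p else 0) = p k
  simp [h]

end HornRetraction

namespace SSet

open HomotopicalAlgebra modelCategoryQuillen

section Singular

variable {X : TopCat.{u}} {n : ℕ} {i : Fin (n + 2)}

theorem horn_range_of_notMem {m : SimplexCategory} (x : m ⟶ ⦋n + 1⦌) {j : Fin (n + 2)} (hj : j ≠ i)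
    (h : ∀ k, x.toOrderHom k ≠ j) :
    (stdSimplex.objEquiv.symm x : (Δ[n + 1] : SSet.{u}).obj (op m)) ∈
      (Λ[n + 1, i] : (Δ[n + 1] : SSet.{u}).Subcomplex).obj (op m) := by
  intro h'
  rcases h' ▸ Set.mem_univ j with ⟨k, hk⟩ | hk
  · exact h k hk
  · exact hj hk

/-- The continuous map given by a face of a map from a horn to a singular simplicial set. -/
noncomputable def evalHorn (t : (Λ[n + 1, i] : SSet.{u}) ⟶ TopCat.toSSet.obj X)
    {m : SimplexCategory} (x : m ⟶ ⦋n + 1⦌)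
    (hx : (stdSimplex.objEquiv.symm x : (Δ[n + 1] : SSet.{u}).obj (op m)) ∈
      (Λ[n + 1, i] : (Δ[n + 1] : SSet.{u}).Subcomplex).obj (op m)) :
    C(_root_.stdSimplex ℝ (Fin (m.len + 1)), X) :=
  X.toSSetObjEquiv (op m) (t.app (op m) ⟨_, hx⟩)

theorem evalHorn_map (t : (Λ[n + 1, i] : SSet.{u}) ⟶ TopCat.toSSet.obj X)
    {m m' : SimplexCategory} (f : m' ⟶ m) (x : m ⟶ ⦋n + 1⦌) (x' : m' ⟶ ⦋n + 1⦌) (h : f ≫ x = x')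
    (hx) (hx') (z : _root_.stdSimplex ℝ (Fin (m'.len + 1))) :
    evalHorn t x hx (_root_.stdSimplex.map f.toOrderHom z) = evalHorn t x' hx' z := by
  subst h
  let y : (Λ[n + 1, i] : SSet.{u}).obj (op m) := ⟨_, hx⟩
  have := NatTrans.naturality_apply t f.op y
  refine Eq.trans ?_ (congrArg (fun s ↦ X.toSSetObjEquiv (op m') s z) this).symm
  rfl

/-- The map on the horn is precomposed with the retraction of the simplex to the horn. Its value is
computed on the face opposite a vertex where the minimal coordinate is attained; the closed sets
belonging to the various vertices form a finite cover, which gives continuity. -/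
theorem exists_extension_horn_toSSet (t : (Λ[n + 1, i] : SSet.{u}) ⟶ TopCat.toSSet.obj X) :
    ∃ w : Δ[n + 1] ⟶ TopCat.toSSet.obj X, Λ[n + 1, i].ι ≫ w = t := by
  -- The vertex `i` lies on both faces. The case `k = j` is allowed and gives the face opposite `j`.
  have hne (j k : Fin (n + 2)) (hj : j ≠ i) (hk : k ≠ i) :
      ((Finset.univ.erase j).erase k).Nonempty :=
    ⟨i, Finset.mem_erase.2 ⟨hk.symm, Finset.mem_erase.2 ⟨hj.symm, Finset.mem_univ _⟩⟩⟩
  choose ρ hρ₁ hρ₂ using fun (j : {j // j ≠ i}) ↦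
    (⦋n + 1⦌ : SimplexCategory).exists_retraction _ (hne j.1 j.1 j.2 j.2)
  have hρ₃ (j) : ∀ k, (ρ j).toOrderHom k ≠ j.1 := fun k ↦ Finset.ne_of_mem_erase (hρ₁ j k)
  let u (j : {j // j ≠ i}) : C(_root_.stdSimplex ℝ (Fin (n + 2)), X) :=
    evalHorn t (ρ j) (horn_range_of_notMem _ j.2 (hρ₃ j))
  -- On the intersection of two faces, both values are computed through a common retraction `σ` onto
  -- that intersection.
  have hu (j k : {j // j ≠ i}) (p : _root_.stdSimplex ℝ (Fin (n + 2))) (hj : p j.1 = 0)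
      (hk : p k.1 = 0) : u j p = u k p := by
    obtain ⟨σ, hσ₁, hσ₂⟩ := (⦋n + 1⦌ : SimplexCategory).exists_retraction _
      (hne j.1 k.1 j.2 k.2)
    have hp : _root_.stdSimplex.map σ.toOrderHom p = p := by
      refine stdSimplex.map_eq_self _ p fun x hx ↦ hσ₂ x ?_
      refine Finset.mem_erase.2 ⟨?_, Finset.mem_erase.2 ⟨?_, Finset.mem_univ _⟩⟩
      · rintro rfl
        exact hx hk
      · rintro rfl
        exact hx hj
    have hσ : ∀ l, σ.toOrderHom l ≠ j.1 := fun l ↦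
      Finset.ne_of_mem_erase (Finset.mem_of_mem_erase (hσ₁ l))
    have hσ' : ∀ l, σ.toOrderHom l ≠ k.1 := fun l ↦ Finset.ne_of_mem_erase (hσ₁ l)
    have e₁ : σ ≫ ρ j = σ := SimplexCategory.Hom.ext _ _ (OrderHom.ext _ _ (funext fun l ↦
      hρ₂ j _ (Finset.mem_erase.2 ⟨hσ l, Finset.mem_erase.2 ⟨hσ l, Finset.mem_univ _⟩⟩)))
    have e₂ : σ ≫ ρ k = σ := SimplexCategory.Hom.ext _ _ (OrderHom.ext _ _ (funext fun l ↦
      hρ₂ k _ (Finset.mem_erase.2 ⟨hσ' l, Finset.mem_erase.2 ⟨hσ' l, Finset.mem_univ _⟩⟩)))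
    have hm := horn_range_of_notMem.{u} σ j.2 hσ
    have h₁ := evalHorn_map t σ (ρ j) σ e₁ (horn_range_of_notMem _ j.2 (hρ₃ j)) hm p
    have h₂ := evalHorn_map t σ (ρ k) σ e₂ (horn_range_of_notMem _ k.2 (hρ₃ k)) hm p
    rw [hp] at h₁ h₂
    exact h₁.trans h₂.symm
  choose c hc₁ hc₂ using exists_eq_minCoord i
  let g (p : _root_.stdSimplex ℝ (Fin (n + 2))) : X := u ⟨c p, hc₁ p⟩ (hornRetraction i p)
  have hg (p) (j : {j // j ≠ i}) (hj : p j.1 = minCoord i p) : g p = u j (hornRetraction i p) :=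
    hu _ _ _ (hornRetraction_apply_eq_zero i p (hc₁ p) (hc₂ p))
      (hornRetraction_apply_eq_zero i p j.2 hj)
  have hgc : Continuous g := by
    refine (locallyFinite_of_finite fun j : {j // j ≠ i} ↦
      Set.ofPred fun p : _root_.stdSimplex ℝ (Fin (n + 2)) ↦ p j.1 = minCoord i p).continuous ?_ ?_ ?_
    · exact Set.eq_univ_of_forall fun p ↦ Set.mem_iUnion.2 ⟨⟨c p, hc₁ p⟩, hc₂ p⟩
    · intro j
      exact isClosed_eq ((continuous_apply j.1).comp continuous_subtype_val) (continuous_minCoord i)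
    · intro j
      exact ((u j).continuous.comp (continuous_hornRetraction i)).continuousOn.congr
        fun p hp ↦ hg p j hp
  refine ⟨yonedaEquiv.symm ((X.toSSetObjEquiv (op ⦋n + 1⦌)).symm ⟨g, hgc⟩), ?_⟩
  refine NatTrans.ext (funext fun m ↦ ConcreteCategory.hom_ext _ _ fun x ↦ ?_)
  obtain ⟨x, hx⟩ := x
  obtain ⟨x, rfl⟩ := stdSimplex.objEquiv.symm.surjective x
  obtain ⟨j, hji, hj⟩ : ∃ j, j ≠ i ∧ ∀ k, x.toOrderHom k ≠ j := by
    obtain ⟨j, hj⟩ := (Set.ne_univ_iff_exists_notMem _).1 hx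
    exact ⟨j, fun h ↦ hj (Or.inr h), fun k hk ↦ hj (Or.inl ⟨k, hk⟩)⟩
  refine (X.toSSetObjEquiv m).injective (ContinuousMap.ext fun z ↦ ?_)
  change g (_root_.stdSimplex.map x.toOrderHom z) = evalHorn t x hx z
  have h0 : _root_.stdSimplex.map x.toOrderHom z j = 0 := stdSimplex.map_apply_eq_zero _ _ _ hj
  have h1 := minCoord_eq_zero i _ hji h0
  rw [hg _ ⟨j, hji⟩ (h0.trans h1.symm), hornRetraction_eq_self i _ h1]
  refine evalHorn_map t x _ x ?_ _ _ z
  exact SimplexCategory.Hom.ext _ _ (OrderHom.ext _ _ (funext fun l ↦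
      hρ₂ _ _ (Finset.mem_erase.2 ⟨hj l, Finset.mem_erase.2 ⟨hj l, Finset.mem_univ _⟩⟩)))

/-- The singular simplicial set of a topological space is a Kan complex. -/
instance kanComplex_toSSet (X : TopCat.{u}) : KanComplex (TopCat.toSSet.obj X) := by
  rw [KanComplex, isFibrant_iff, modelCategoryQuillen.fibration_iff]
  intro _ _ _ hf
  simp only [modelCategoryQuillen.J, MorphismProperty.iSup_iff] at hf
  obtain ⟨n, ⟨i⟩⟩ := hf
  refine ⟨fun {t _} _ ↦ ?_⟩
  obtain ⟨w, hw⟩ := exists_extension_horn_toSSet t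
  exact ⟨⟨{ l := w, fac_left := hw, fac_right := by subsingleton }⟩⟩

end Singular

/-! ### The last vertex embedding and extension over the cone. -/

section Vertices

theorem Cyl.top_map {L M : Type} [LinearOrder L] [LinearOrder M] (f : L →o M) (q : Cyl.{u} L) :
    (q.map f).top = f q.top := by
  refine le_antisymm (Finset.max'_le _ _ _ fun i hi ↦ ?_) (Finset.le_max' _ _ ?_)
  · rw [Cyl.supp_map] at hi
    obtain ⟨j, hj, rfl⟩ := Finset.mem_image.1 hi
    exact f.monotone (Finset.le_max' _ _ hj)
  · rw [Cyl.supp_map]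
    exact Finset.mem_image_of_mem _ (Finset.max'_mem _ _)

/-- The monotone map of greatest vertices of a simplex of the mapping cylinder. -/
def Cyl.topHom {n : SimplexCategory} {k : SimplexCategoryᵒᵖ}
    (s : (nerve (Cyl.{u} (Fin (n.len + 1)))).obj k) : k.unop ⟶ n :=
  SimplexCategory.Hom.mk ⟨fun i ↦ (s.obj i).top, fun _ _ h ↦ Cyl.top_mono (nerve_monotone s h)⟩

/-- The morphism which sends a simplex `x` of `K` to the map from the mapping cylinder to `K` given
by the projection of the mapping cylinder to the standard simplex and `x`. -/
def toMapsFromCyl (K : SSet.{u}) : K ⟶ mapsFrom cylCosimplicial K where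
  app n := ↾fun x ↦
    { app := fun k ↦ ↾fun s ↦ K.map (Cyl.topHom (n := n.unop) s).op x
      naturality := fun k k' f ↦ by
        refine ConcreteCategory.hom_ext _ _ fun s ↦ ?_
        exact Functor.map_comp_apply K (Cyl.topHom (n := n.unop) s).op f x }
  naturality n m f := by
    refine ConcreteCategory.hom_ext _ _ fun x ↦ ?_
    refine NatTrans.ext (funext fun k ↦ ConcreteCategory.hom_ext _ _ fun s ↦ ?_)
    have h : Cyl.topHom (n := n.unop) ((cylCosimplicial.map f.unop).app k s) =
        Cyl.topHom (n := m.unop) s ≫ f.unop :=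
      SimplexCategory.Hom.ext _ _ (OrderHom.ext _ _
        (funext fun i ↦ Cyl.top_map f.unop.toOrderHom _))
    change K.map (Cyl.topHom (n := m.unop) s).op (K.map f x) =
      K.map (Cyl.topHom (n := n.unop) ((cylCosimplicial.map f.unop).app k s)).op x
    rw [h]
    exact (Functor.map_comp_apply K f (Cyl.topHom (n := m.unop) s).op x).symm

/-- The simplex of the mapping cylinder whose vertices are the vertices of the standard simplex. -/
def Cyl.vertices (n : SimplexCategory) : (nerve (Cyl.{u} (Fin (n.len + 1)))).obj (op n) :=
  nerveMk ⟨Cyl.vertex, Cyl.vertex_mono⟩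

/-- The restriction of maps from the mapping cylinders to the standard simplices. -/
def fromMapsFromCyl (K : SSet.{u}) : mapsFrom cylCosimplicial K ⟶ K where
  app n := ↾fun w ↦ w.app n (Cyl.vertices n.unop)
  naturality n m f := by
    refine ConcreteCategory.hom_ext _ _ fun w ↦ ?_
    exact NatTrans.naturality_apply w f (Cyl.vertices n.unop)

theorem toMapsFromCyl_comp_fromMapsFromCyl (K : SSet.{u}) :
    toMapsFromCyl K ≫ fromMapsFromCyl K = 𝟙 K := by
  refine NatTrans.ext (funext fun n ↦ ConcreteCategory.hom_ext _ _ fun x ↦ ?_)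
  refine Eq.trans ?_ (ConcreteCategory.congr_hom (K.map_id n) x)
  rfl

/-- The chain of initial segments `Finset.Iic i` has last vertices `i`, so evaluating on it recovers
the simplex. -/
instance (K : SSet.{u}) : Mono (toMapsFromCyl K ≫ mapsFromPre faceToCyl K) := by
  refine (NatTrans.mono_iff_mono_app _).2 fun n ↦ (mono_iff_injective _).2 fun x y h ↦ ?_
  let s : (nerve (Face.{u} (Fin (n.unop.len + 1)))).obj n := nerveMk
    { toFun := fun i ↦ ⟨Finset.Iic i, i, Finset.mem_Iic.2 le_rfl⟩
      monotone' := fun i j h ↦ Finset.Iic_subset_Iic.2 h }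
  have hs : Cyl.topHom (n := n.unop) ((faceToCyl.app n.unop).app n s) = 𝟙 _ := by
    refine SimplexCategory.Hom.ext _ _ (OrderHom.ext _ _ (funext fun i ↦ ?_))
    change (Finset.Iic i).max' ⟨i, Finset.mem_Iic.2 le_rfl⟩ = i
    exact le_antisymm (Finset.max'_le _ _ _ fun j hj ↦ Finset.mem_Iic.1 hj)
      (Finset.le_max' _ _ (Finset.mem_Iic.2 le_rfl))
  have h' := ConcreteCategory.congr_hom (NatTrans.congr_app h n) s
  change K.map (Cyl.topHom (n := n.unop) ((faceToCyl.app n.unop).app n s)).op x =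
    K.map (Cyl.topHom (n := n.unop) ((faceToCyl.app n.unop).app n s)).op y at h'
  rw [hs] at h'
  simpa using h'

theorem toMapsFromCyl_naturality {K K' : SSet.{u}} (g : K ⟶ K') :
    (toMapsFromCyl K ≫ mapsFromPre faceToCyl K) ≫ mapsFromPost _ g =
      (g ≫ toMapsFromCyl K') ≫ mapsFromPre faceToCyl K' := by
  refine NatTrans.ext (funext fun n ↦ ConcreteCategory.hom_ext _ _ fun x ↦ ?_)
  refine NatTrans.ext (funext fun k ↦ ConcreteCategory.hom_ext _ _ fun s ↦ ?_)
  exact NatTrans.naturality_apply g _ x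

instance (A B : SSet.{u}) : Mono (joinInl A B) := by
  refine (NatTrans.mono_iff_mono_app _).2 fun n ↦ (mono_iff_injective _).2 fun x y h ↦ ?_
  have h' : ∀ (s t : JoinSimplex A B n.unop), s = t → ∀ hs ht,
      s.left n.unop (𝟙 _) hs = t.left n.unop (𝟙 _) ht := by
    rintro s _ rfl _ _
    rfl
  have := h' _ _ h (fun _ ↦ rfl) (fun _ ↦ rfl)
  change A.map (𝟙 _) x = A.map (𝟙 _) y at this
  simpa using this

theorem rlp_monomorphisms_of_boundary {E S : SSet.{u}} (p : E ⟶ S)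
    (h : ∀ (n : ℕ) (t : (∂Δ[n] : SSet.{u}) ⟶ E) (b : Δ[n] ⟶ S), t ≫ p = ∂Δ[n].ι ≫ b →
      ∃ l : Δ[n] ⟶ E, ∂Δ[n].ι ≫ l = t ∧ l ≫ p = b) :
    (MorphismProperty.monomorphisms SSet.{u}).rlp p := by
  rw [rlp_monomorphisms]
  rintro _ _ _ ⟨n⟩
  refine ⟨fun {t b} sq ↦ ?_⟩
  obtain ⟨l, hl, hl'⟩ := h n t b sq.w
  exact ⟨⟨{ l := l, fac_left := hl, fac_right := hl' }⟩⟩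

/-- If maps from nerves of finite partially ordered sets to `C` extend to cones, then every map
from `C` to a Kan complex extends to the cone on `C`. -/
theorem exists_extension_join {C : SSet.{u}}
    (hext : ∀ (P : Type u) [PartialOrder P] [Finite P] (f : nerve P ⟶ C),
      ∃ g : SSet.join (nerve P) Δ[0] ⟶ C, SSet.joinInl (nerve P) Δ[0] ≫ g = f)
    (K : SSet.{u}) [KanComplex K] (g : C ⟶ K) :
    ∃ h : join C Δ[0] ⟶ K, joinInl C Δ[0] ≫ h = g := by
  have hW : (MorphismProperty.monomorphisms SSet.{u}).rlp
      (Limits.terminal.from (mapsFrom faceCosimplicial C)) := by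
    refine rlp_monomorphisms_of_boundary _ fun n t b _ ↦ ?_
    obtain ⟨l, hl⟩ := exists_extension_mapsFrom_faceCosimplicial C hext n t
    exact ⟨l, hl, Subsingleton.elim _ _⟩
  have hK := rlp_monomorphisms_of_boundary _ (exists_lift_mapsFromPre K)
  have := hW _ (MorphismProperty.monomorphisms.infer_property (joinInl C Δ[0]))
  have := hK _ (MorphismProperty.monomorphisms.infer_property
    (toMapsFromCyl C ≫ mapsFromPre faceToCyl C))
  -- The lift of `sq` extends the last vertex embedding of `C` over the cone. The lift of `sq'`
  -- carries `mapsFrom faceCosimplicial C` to the cylinder object of `K`, compatibly with `g`.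
  have sq : CommSq (toMapsFromCyl C ≫ mapsFromPre faceToCyl C) (joinInl C Δ[0])
    (Limits.terminal.from (mapsFrom faceCosimplicial C)) (Limits.terminal.from _) := ⟨by simp⟩
  have sq' : CommSq (g ≫ toMapsFromCyl K) (toMapsFromCyl C ≫ mapsFromPre faceToCyl C)
    (mapsFromPre faceToCyl K) (mapsFromPost _ g) := ⟨(toMapsFromCyl_naturality g).symm⟩
  refine ⟨sq.lift ≫ sq'.lift ≫ fromMapsFromCyl K, ?_⟩
  rw [sq.fac_left_assoc, sq'.fac_left_assoc, Category.assoc, toMapsFromCyl_comp_fromMapsFromCyl,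
    Category.comp_id]

end Vertices

/-! ### Contracting the realization by means of the cone. -/

section Contraction

/-- The cone on a morphism of the simplex category. -/
def coneHom {m n : SimplexCategory} (f : m ⟶ n) : ⦋m.len + 1⦌ ⟶ ⦋n.len + 1⦌ :=
  SimplexCategory.Hom.mk
    { toFun := fun i ↦ if h : i = Fin.last _ then Fin.last _ else
        (f.toOrderHom (i.castPred h)).castSucc
      monotone' := fun i j hij ↦ by
        dsimp only
        split_ifs with h1 h2 h2
        · exact le_rfl
        · exact absurd (Fin.last_le_iff.1 (h1.symm.le.trans hij)) h2
        · exact Fin.le_last _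
        · exact Fin.castSucc_le_castSucc_iff.2 (f.toOrderHom.monotone hij) }

theorem coneHom_castSucc {m n : SimplexCategory} (f : m ⟶ n) (i : Fin (m.len + 1)) :
    (coneHom f).toOrderHom i.castSucc = (f.toOrderHom i).castSucc :=
  dif_neg (Fin.castSucc_ne_last i)

theorem coneHom_last {m n : SimplexCategory} (f : m ⟶ n) :
    (coneHom f).toOrderHom (Fin.last _) = Fin.last _ :=
  dif_pos rfl

/-- The corestriction of a monotone map that avoids the last vertex. -/
def castPredHom {m n : SimplexCategory} (φ : m ⟶ ⦋n.len + 1⦌)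
    (h : ∀ i, φ.toOrderHom i ≠ Fin.last _) : m ⟶ n :=
  SimplexCategory.Hom.mk
    { toFun := fun i ↦ (φ.toOrderHom i).castPred (h i)
      monotone' := fun _ _ hij ↦ φ.toOrderHom.monotone hij }

theorem castPredHom_coneHom {k m n : SimplexCategory} (f : m ⟶ n) (φ : k ⟶ ⦋m.len + 1⦌)
    (h : ∀ i, φ.toOrderHom i ≠ Fin.last _) (h' : ∀ i, (φ ≫ coneHom f).toOrderHom i ≠ Fin.last _) :
    castPredHom (φ ≫ coneHom f) h' = castPredHom φ h ≫ f := by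
  refine SimplexCategory.Hom.ext _ _ (OrderHom.ext _ _ (funext fun i ↦ ?_))
  exact Fin.castSucc_injective _ (coneHom_castSucc f ((φ.toOrderHom i).castPred (h i)))

/-- The inclusion of a simplex as the face opposite to the last vertex of its cone. -/
def castSuccHom (n : SimplexCategory) : n ⟶ ⦋n.len + 1⦌ :=
  SimplexCategory.Hom.mk Fin.castSuccOrderEmb.toOrderHom

/-- The cone on a simplex of `A`. -/
def coneSimplex (A : SSet.{u}) {n : SimplexCategoryᵒᵖ} (x : A.obj n) :
    (join A Δ[0]).obj (op ⦋n.unop.len + 1⦌) :=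
  { cut := SimplexCategory.Hom.mk
      { toFun := fun i ↦ if i = Fin.last _ then (1 : Fin 2) else 0
        monotone' := fun i j hij ↦ by
          dsimp only
          split_ifs with h1 h2
          · exact le_rfl
          · exact absurd (Fin.last_le_iff.1 (h1.symm.le.trans hij)) h2
          · exact Fin.zero_le _
          · exact le_rfl }
    left := fun m φ h ↦ A.map (castPredHom φ fun i hi ↦
      absurd (show (1 : Fin 2) = 0 from (if_pos hi).symm.trans (h i)) (by decide)).op x
    left_map := fun m m' ψ φ h h' ↦ (Functor.map_comp_apply A (castPredHom φ _).op ψ.op x).symm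
    right := fun m φ h ↦ stdSimplex.objEquiv.symm (SimplexCategory.const m ⦋0⦌ 0)
    right_map := fun m m' ψ φ h h' ↦ rfl }

theorem coneSimplex_map (A : SSet.{u}) {n m : SimplexCategoryᵒᵖ} (f : n ⟶ m) (x : A.obj n) :
    coneSimplex A (A.map f x) = (join A Δ[0]).map (coneHom f.unop).op (coneSimplex A x) := by
  refine JoinSimplex.ext' ?_ ?_ ?_
  · refine SimplexCategory.Hom.ext _ _ (OrderHom.ext _ _ (funext fun i ↦ ?_))
    change (if _ then (1 : Fin 2) else 0) =
      if (coneHom f.unop).toOrderHom i = Fin.last _ then (1 : Fin 2) else 0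
    induction i using Fin.lastCases with
    | last => rw [if_pos rfl, if_pos (coneHom_last _)]
    | cast i =>
      rw [if_neg (Fin.castSucc_ne_last i), coneHom_castSucc, if_neg (Fin.castSucc_ne_last _)]
  · intro k φ h h'
    change A.map (castPredHom φ _).op (A.map f x) = A.map (castPredHom (φ ≫ coneHom f.unop) _).op x
    rw [castPredHom_coneHom]
    exact (Functor.map_comp_apply A f (castPredHom φ _).op x).symm
  · intro k φ h h'
    rfl

theorem coneSimplex_face (A : SSet.{u}) {n : SimplexCategoryᵒᵖ} (x : A.obj n) :
    (join A Δ[0]).map (castSuccHom n.unop).op (coneSimplex A x) =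
      (joinInl A Δ[0]).app n x := by
  refine JoinSimplex.ext' ?_ ?_ ?_
  · refine SimplexCategory.Hom.ext _ _ (OrderHom.ext _ _ (funext fun i ↦ ?_))
    exact if_neg (Fin.castSucc_ne_last i)
  · intro k φ h h'
    change A.map (castPredHom (φ ≫ castSuccHom n.unop) _).op x = A.map φ.op x
    exact congrArg (fun ψ : k ⟶ n.unop ↦ A.map ψ.op x)
      (SimplexCategory.Hom.ext _ _ (OrderHom.ext _ _ (funext fun i ↦ rfl)))
  · intro k φ h h'
    exact absurd (show (0 : Fin 2) = 1 from h' 0) (by decide)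

/-- All cones share one cone point; hence the homotopies on the individual simplices all end at the
same point. -/
theorem coneSimplex_vertex (A : SSet.{u}) {n n' : SimplexCategoryᵒᵖ} (x : A.obj n)
    (x' : A.obj n') :
    (join A Δ[0]).map (SimplexCategory.const ⦋0⦌ ⦋n.unop.len + 1⦌ (Fin.last _)).op
        (coneSimplex A x) =
      (join A Δ[0]).map (SimplexCategory.const ⦋0⦌ ⦋n'.unop.len + 1⦌ (Fin.last _)).op
        (coneSimplex A x') := by
  refine JoinSimplex.ext' ?_ ?_ ?_
  · refine SimplexCategory.Hom.ext _ _ (OrderHom.ext _ _ (funext fun i ↦ ?_))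
    exact (if_pos rfl).trans (if_pos rfl).symm
  · intro k φ h h'
    exact absurd ((if_pos rfl).symm.trans (h 0)) (by decide)
  · intro k φ h h'
    rfl

/-- The point of the cone on the topological simplex with base `t` and height `s`. -/
noncomputable def conePoint {n : ℕ} (t : _root_.stdSimplex ℝ (Fin (n + 1))) (s : unitInterval) :
    _root_.stdSimplex ℝ (Fin (n + 2)) :=
  ⟨(1 - s : ℝ) • (_root_.stdSimplex.map Fin.castSucc t).1 +
    (s : ℝ) • (stdSimplex.vertex (S := ℝ) (Fin.last (n + 1))).1,
    convex_stdSimplex ℝ _ (Subtype.property _) (Subtype.property _) (by linarith [s.2.2]) s.2.1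
      (by ring)⟩

theorem continuous_conePoint (n : ℕ) :
    Continuous fun p : _root_.stdSimplex ℝ (Fin (n + 1)) × unitInterval ↦
      conePoint p.1 p.2 := by
  refine Continuous.subtype_mk ?_ _
  have h1 : Continuous fun p : _root_.stdSimplex ℝ (Fin (n + 1)) × unitInterval ↦ (p.2 : ℝ) :=
    continuous_subtype_val.comp continuous_snd
  have h2 : Continuous fun p : _root_.stdSimplex ℝ (Fin (n + 1)) × unitInterval ↦
      (_root_.stdSimplex.map (Fin.castSucc (n := n + 1)) p.1).1 :=
    continuous_subtype_val.comp ((stdSimplex.continuous_map _).comp continuous_fst)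
  exact ((continuous_const.sub h1).smul h2).add (h1.smul continuous_const)

theorem conePoint_zero {n : ℕ} (t : _root_.stdSimplex ℝ (Fin (n + 1))) :
    conePoint t 0 = _root_.stdSimplex.map Fin.castSucc t := by
  refine Subtype.ext ?_
  simp [conePoint]

theorem conePoint_one {n : ℕ} (t : _root_.stdSimplex ℝ (Fin (n + 1))) :
    conePoint t 1 = stdSimplex.vertex (Fin.last (n + 1)) := by
  refine Subtype.ext ?_
  simp [conePoint]

theorem map_conePoint {m n : SimplexCategory} (f : m ⟶ n)
    (t : _root_.stdSimplex ℝ (Fin (m.len + 1))) (s : unitInterval) :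
    _root_.stdSimplex.map (coneHom f).toOrderHom (conePoint t s) =
      conePoint (_root_.stdSimplex.map f.toOrderHom t) s := by
  have h1 : _root_.stdSimplex.map (coneHom f).toOrderHom (_root_.stdSimplex.map Fin.castSucc t) =
      _root_.stdSimplex.map Fin.castSucc (_root_.stdSimplex.map f.toOrderHom t) := by
    rw [stdSimplex.map_comp_apply, stdSimplex.map_comp_apply]
    congr 1
    exact funext fun i ↦ coneHom_castSucc f i
  have h2 : _root_.stdSimplex.map (coneHom f).toOrderHom
      (stdSimplex.vertex (S := ℝ) (Fin.last (m.len + 1))) =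
        stdSimplex.vertex (Fin.last (n.len + 1)) := by
    rw [stdSimplex.map_vertex, coneHom_last]
  refine Subtype.ext ?_
  -- The map of topological simplices is the restriction of a linear map, so it preserves the convex
  -- combination.
  refine (map_add _ _ _).trans (congrArg₂ _ ?_ ?_)
  · exact (map_smul _ _ _).trans (congrArg _ (congrArg Subtype.val h1))
  · exact (map_smul _ _ _).trans (congrArg _ (congrArg Subtype.val h2))

variable {C : SSet.{u}} {X : TopCat.{u}} (h : join C Δ[0] ⟶ TopCat.toSSet.obj X)

/-- The homotopy on a simplex of `C` given by a map from the cone on `C` to `X`. -/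
noncomputable def coneHomotopy {n : SimplexCategoryᵒᵖ} (x : C.obj n) :
    C(_root_.stdSimplex ℝ (Fin (n.unop.len + 1)) × unitInterval, X) :=
  (X.toSSetObjEquiv (op ⦋n.unop.len + 1⦌) (h.app _ (coneSimplex C x))).comp
    ⟨_, continuous_conePoint _⟩

/-- The morphism from `C` to the singular simplices of the path space given by a map from the cone
on `C` to `X`. -/
noncomputable def toPathSpace : C ⟶ TopCat.toSSet.obj (TopCat.of C(unitInterval, X)) where
  app n := ↾fun x ↦ (TopCat.toSSetObjEquiv _ n).symm (coneHomotopy h x).curry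
  naturality n m f := by
    refine ConcreteCategory.hom_ext _ _ fun x ↦ ?_
    refine (TopCat.toSSetObjEquiv _ m).injective (ContinuousMap.ext fun t ↦
      ContinuousMap.ext fun s ↦ ?_)
    change X.toSSetObjEquiv (op ⦋m.unop.len + 1⦌) (h.app _ (coneSimplex C (C.map f x)))
        (conePoint t s) =
      X.toSSetObjEquiv (op ⦋n.unop.len + 1⦌) (h.app _ (coneSimplex C x))
        (conePoint (_root_.stdSimplex.map f.unop.toOrderHom t) s)
    rw [coneSimplex_map, NatTrans.naturality_apply, ← map_conePoint]
    rfl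

/-- The evaluation of paths. -/
def evalPath (X : TopCat.{u}) (s : unitInterval) : TopCat.of C(unitInterval, X) ⟶ X :=
  TopCat.ofHom ⟨fun γ ↦ γ s, continuous_eval_const s⟩

theorem toPathSpace_zero :
    toPathSpace h ≫ TopCat.toSSet.map (evalPath X 0) = joinInl C Δ[0] ≫ h := by
  refine NatTrans.ext (funext fun n ↦ ConcreteCategory.hom_ext _ _ fun x ↦ ?_)
  refine (TopCat.toSSetObjEquiv _ n).injective (ContinuousMap.ext fun t ↦ ?_)
  change X.toSSetObjEquiv (op ⦋n.unop.len + 1⦌) (h.app _ (coneSimplex C x)) (conePoint t 0) =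
    X.toSSetObjEquiv n (h.app n ((joinInl C Δ[0]).app n x)) t
  rw [← coneSimplex_face, NatTrans.naturality_apply, conePoint_zero]
  rfl

theorem coneHomotopy_one {n n' : SimplexCategoryᵒᵖ} (x : C.obj n) (x' : C.obj n') (t t') :
    coneHomotopy h x (t, 1) = coneHomotopy h x' (t', 1) := by
  have key {n : SimplexCategoryᵒᵖ} (x : C.obj n) (t) : coneHomotopy h x (t, 1) =
      X.toSSetObjEquiv (op ⦋0⦌) (h.app _ ((join C Δ[0]).map
        (SimplexCategory.const ⦋0⦌ ⦋n.unop.len + 1⦌ (Fin.last _)).op (coneSimplex C x)))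
        (stdSimplex.vertex 0) := by
    change X.toSSetObjEquiv (op ⦋n.unop.len + 1⦌) (h.app _ (coneSimplex C x)) (conePoint t 1) = _
    rw [NatTrans.naturality_apply, conePoint_one]
    have : stdSimplex.vertex (S := ℝ) (Fin.last (n.unop.len + 1)) = _root_.stdSimplex.map
        (SimplexCategory.const ⦋0⦌ ⦋n.unop.len + 1⦌ (Fin.last _)).toOrderHom
        (stdSimplex.vertex 0) := by
      rw [stdSimplex.map_vertex]
      rfl
    rw [this]
    rfl
  rw [key, key, coneSimplex_vertex]

/-- If the unit of the geometric realization of `C` extends to the cone on `C`, then the geometric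
realization of `C` is contractible. -/
theorem contractibleSpace_toTop [C.Nonempty]
    (h : join C Δ[0] ⟶ TopCat.toSSet.obj (toTop.obj C))
    (hh : joinInl C Δ[0] ≫ h = sSetTopAdj.unit.app C) : ContractibleSpace (toTop.obj C) := by
  -- By adjunction, the compatible homotopies on simplices become a single map from the realization
  -- to the path space; uncurrying it gives the contraction.
  let G : toTop.obj C ⟶ TopCat.of C(unitInterval, toTop.obj C) :=
    (sSetTopAdj.homEquiv _ _).symm (toPathSpace h)
  let x₀ : C.obj (op ⦋0⦌) := Classical.arbitrary _
  let p : toTop.obj C := coneHomotopy h x₀ (stdSimplex.vertex 0, 1)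
  have h0 : G ≫ evalPath _ 0 = 𝟙 _ := by
    refine (sSetTopAdj.homEquiv _ _).injective ?_
    rw [Adjunction.homEquiv_naturality_right, Equiv.apply_symm_apply, toPathSpace_zero, hh,
      Adjunction.homEquiv_id]
  have h1 : G ≫ evalPath _ 1 = TopCat.ofHom (ContinuousMap.const _ p) := by
    refine (sSetTopAdj.homEquiv _ _).injective ?_
    rw [Adjunction.homEquiv_naturality_right, Equiv.apply_symm_apply, Adjunction.homEquiv_unit]
    refine NatTrans.ext (funext fun n ↦ ConcreteCategory.hom_ext _ _ fun x ↦ ?_)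
    refine (TopCat.toSSetObjEquiv _ n).injective (ContinuousMap.ext fun t ↦ ?_)
    exact coneHomotopy_one h x x₀ t _
  rw [contractible_iff_id_nullhomotopic]
  refine ⟨p, ⟨⟨G.hom.uncurry.comp ContinuousMap.prodSwap, fun y ↦ ?_, fun y ↦ ?_⟩⟩⟩
  · exact ConcreteCategory.congr_hom h0 y
  · exact ConcreteCategory.congr_hom h1 y

end Contraction

end SSet

theorem mainTheorem12 (C : SSet.{u}) (hC : C.Nonempty)
    (hext : ∀ (P : Type u) [PartialOrder P] [Finite P] (f : nerve P ⟶ C),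
      ∃ g : SSet.join (nerve P) Δ[0] ⟶ C, SSet.joinInl (nerve P) Δ[0] ≫ g = f) :
    C.IsWeaklyContractible := by
  obtain ⟨h, hh⟩ := SSet.exists_extension_join hext
    (TopCat.toSSet.obj (SSet.toTop.obj C)) (sSetTopAdj.unit.app C)
  have := SSet.contractibleSpace_toTop h hh
  refine ⟨inferInstance, fun n hn x ↦ ?_⟩
  have : Nonempty (Fin n) := ⟨⟨0, hn⟩⟩
  exact ContractibleSpace.subsingleton_homotopyGroup x
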